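/- **Setting.** All systems are finite-dimensional and bipartite, $\mathcal H=\mathcal H^A\otimes\mathcal H^B$; states are density operators, and $\|X\|_1=\operatorname{tr}\sqrt{X^\dagger X}$. The quantum relative entropy is $D(\rho\|\sigma)=\operatorname{tr}(\rho\log_2\rho)-\operatorname{tr}(\rho\log_2\sigma)$ if $\operatorname{supp}\rho\subseteq\operatorname{supp}\sigma$ and $+\infty$ otherwise, and $h_2(x)=-x\log_2x-(1-x)\log_2(1-x)$. The composite of systems $AB$ and $A'B'$ is the bipartite system with parties $AA'$ and $BB'$; $\mathcal H^{\otimes n}$ and $\phi^{\otimes n}$ are understood in this way. The set $\mathrm{CC}$ of classical-classical states of $\mathcal H$ consists of the states $\sum_{i,j}p_{ij}\,|a_i\rangle\langle a_i|\otimes|b_j\rangle\langle b_j|$ with orthonormal bases $(|a_i\rangle)$ of $\mathcal H^A$ and $(|b_j\rangle)$ of $\mathcal H^B$ and a probability distribution $(p_{ij})$. The relative entropy of discord is $D^{\mathrm{CC}}_{\mathrm{rel}}(\phi)=\min_{\sigma\in\mathrm{CC}}D(\phi\|\sigma)$, and its regularization is $D^{\mathrm{CC},\infty}_{\mathrm{rel}}(\phi)=\lim_{n\to\infty}D^{\mathrm{CC}}_{\mathrm{rel}}(\phi^{\otimes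 n})/n$. A class $\mathcal O$ of free operations is any family of completely positive trace-preserving linear maps between such systems that map classical-classical states to classical-classical states. For states $\phi$ on $\mathcal H$ and $\psi$ on $\mathcal H'$, a number $r\ge0$ is an achievable rate if there are $\mathcal N_n\in\mathcal O$ ($n\ge1$) from $\mathcal H^{\otimes n}$ to $\mathcal H'^{\otimes\lceil rn\rceil}$ with $\liminf_{n\to\infty}\|\mathcal N_n(\phi^{\otimes n})-\psi^{\otimes\lceil rn\rceil}\|_1=0$, and $r_{\mathcal O}(\phi\to\psi)\in[0,\infty]$ is the supremum of the achievable rates ($0$ if there is none). We set $0\cdot\infty=0$. **Theorem.** 1. The minimum defining $D^{\mathrm{CC}}_{\mathrm{rel}}(\phi)$ is attained and finite for every state $\phi$. 2. For all states $\phi,\psi$ on $\mathcal H=\mathcal H^A\otimes\mathcal H^B$, with $D=\dim\mathcal H$, $$|D^{\mathrm{CC}}_{\mathrm{rel}}(\phi)-D^{\mathrm{CC}}_{\mathrm{rel}}(\psi)|\le\|\phi-\psi\|_1\log_2D+2h_2\!\left(\tfrac12\|\phi-\psi\|_1\right).$$ 3. $D^{\mathrm{CC}}_{\mathrm{rel}}$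 is asymptotically continuous: for every $\mathcal H$, every sequence of positive integers $(n_i)$ and all states $\phi_i,\psi_i$ on $\mathcal H^{\otimes n_i}$ with $\|\phi_i-\psi_i\|_1\to0$, we have $|D^{\mathrm{CC}}_{\mathrm{rel}}(\phi_i)-D^{\mathrm{CC}}_{\mathrm{rel}}(\psi_i)|/n_i\to0$. 4. The limit defining $D^{\mathrm{CC},\infty}_{\mathrm{rel}}(\phi)$ exists and is finite for every state $\phi$. 5. Let $\mathcal O$ be any class of free operations. Then $D^{\mathrm{CC}}_{\mathrm{rel}}$ does not increase under the operations in $\mathcal O$, and its regularization is consistent: for all states $\phi,\psi$ (possibly of different systems) $$D^{\mathrm{CC},\infty}_{\mathrm{rel}}(\psi)\,r_{\mathcal O}(\phi\to\psi)\le D^{\mathrm{CC},\infty}_{\mathrm{rel}}(\phi).$$ If moreover $\mathcal O$ contains the identity maps and is closed under tensor products, then $D^{\mathrm{CC},\infty}_{\mathrm{rel}}$ does not increase under the operations in $\mathcal O$ either. -/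

import Mathlib

open scoped ComplexOrder NNReal ENNReal Kronecker
open Filter Topology

noncomputable section

namespace Discord

/-! ## States, trace norm, entropy -/

/-- A state of the finite-dimensional quantum system with Hilbert space `ℂ^n`: a density matrix. -/
structure QState (n : Type) [Fintype n] where
  mat : Matrix n n ℂ
  posSemidef : mat.PosSemidef
  trace_eq_one : mat.trace = 1

/-- The trace norm `‖M‖₁ = tr √(Mᴴ M)`: the sum of the singular values of `M`. -/
def traceNorm {n : Type} [Fintype n] [DecidableEq n] (M : Matrix n n ℂ) : ℝ :=
  ∑ i, √((Matrix.isHermitian_conjTranspose_mul_self M).eigenvalues i)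

/-- The support of a Hermitian matrix, that is, the orthogonal complement of its kernel, which is
its range. -/
def supp {n : Type} [Fintype n] (M : Matrix n n ℂ) : Submodule ℂ (n → ℂ) :=
  LinearMap.range M.mulVecLin

/-- `log₂ ρ`, by functional calculus on the spectral decomposition of `ρ`. As `Real.logb 2 0 = 0`,
the logarithm is taken on the support of `ρ` and is zero on its kernel. -/
def log₂ {n : Type} [Fintype n] [DecidableEq n] (ρ : QState n) : Matrix n n ℂ :=
  ρ.posSemidef.isHermitian.cfc (Real.logb 2)

open Classical in
/-- The quantum relative entropy: `tr (ρ log₂ ρ) - tr (ρ log₂ σ)` if `supp ρ ⊆ supp σ`, and `+∞`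
otherwise. -/
def relEntropy {n : Type} [Fintype n] [DecidableEq n] (ρ σ : QState n) : EReal :=
  if supp ρ.mat ≤ supp σ.mat then
    (((ρ.mat * log₂ ρ).trace - (ρ.mat * log₂ σ).trace).re : EReal)
  else ⊤

/-- The binary entropy function (logarithms to base 2). -/
def h₂ (x : ℝ) : ℝ := -x * Real.logb 2 x - (1 - x) * Real.logb 2 (1 - x)

/-! ## Bipartite systems -/

/-- A bipartite system `ℂ^A ⊗ ℂ^B`. -/
structure BipartiteSystem where
  A : Type
  B : Type
  [fintypeA : Fintype A]
  [fintypeB : Fintype B]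
  [decEqA : DecidableEq A]
  [decEqB : DecidableEq B]

attribute [instance] BipartiteSystem.fintypeA BipartiteSystem.fintypeB
  BipartiteSystem.decEqA BipartiteSystem.decEqB

/-- The index set of the product basis of `ℂ^A ⊗ ℂ^B`. -/
abbrev BipartiteSystem.Idx (S : BipartiteSystem) : Type := S.A × S.B

/-- The dimension of `ℂ^A ⊗ ℂ^B`. -/
def BipartiteSystem.dim (S : BipartiteSystem) : ℕ := Fintype.card S.Idx

/-- Operators on a bipartite system. -/
abbrev Op (S : BipartiteSystem) : Type := Matrix S.Idx S.Idx ℂ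

/-- States on a bipartite system. -/
abbrev State (S : BipartiteSystem) : Type := QState S.Idx

/-- The trivial (one-dimensional) system. -/
def BipartiteSystem.trivial : BipartiteSystem where
  A := Unit
  B := Unit

/-- The composite of two bipartite systems `AB` and `A'B'`, seen as a bipartite system with
parties `AA'` and `BB'`. -/
def BipartiteSystem.tensor (S T : BipartiteSystem) : BipartiteSystem where
  A := S.A × T.A
  B := S.B × T.B

/-- `n` copies of a bipartite system, as a bipartite system with parties `Aⁿ` and `Bⁿ`. -/
def BipartiteSystem.pow (S : BipartiteSystem) : ℕ → BipartiteSystem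
  | 0 => .trivial
  | n + 1 => (S.pow n).tensor S

/-- The identification of `(ℂ^A ⊗ ℂ^B) ⊗ (ℂ^A' ⊗ ℂ^B')` with
`(ℂ^A ⊗ ℂ^A') ⊗ (ℂ^B ⊗ ℂ^B')` on basis vectors. -/
def regroup (S T : BipartiteSystem) : S.Idx × T.Idx ≃ (S.tensor T).Idx :=
  Equiv.prodProdProdComm S.A S.B T.A T.B

/-- The tensor product of operators on two bipartite systems. -/
def tensorOp {S T : BipartiteSystem} (X : Op S) (Y : Op T) : Op (S.tensor T) :=
  Matrix.reindex (regroup S T) (regroup S T) (X ⊗ₖ Y)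

/-- The tensor product of states of two bipartite systems. -/
def State.tensor {S T : BipartiteSystem} (ρ : State S) (σ : State T) : State (S.tensor T) where
  mat := tensorOp ρ.mat σ.mat
  posSemidef := (ρ.posSemidef.kronecker σ.posSemidef).submatrix _
  trace_eq_one := by
    have h : (tensorOp ρ.mat σ.mat).trace = (ρ.mat ⊗ₖ σ.mat).trace :=
      (regroup S T).symm.sum_comp fun i => (ρ.mat ⊗ₖ σ.mat) i i
    rw [h, Matrix.trace_kronecker, ρ.trace_eq_one, σ.trace_eq_one, one_mul]

/-- The only state of the trivial system. -/
def State.trivial : State .trivial where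
  mat := (1 : Matrix (Unit × Unit) (Unit × Unit) ℂ)
  posSemidef := Matrix.PosSemidef.one
  trace_eq_one := by
    change (1 : Matrix (Unit × Unit) (Unit × Unit) ℂ).trace = 1
    simp

/-- `n` copies `ρ^{⊗ n}` of a state. -/
def State.pow {S : BipartiteSystem} (ρ : State S) : (n : ℕ) → State (S.pow n)
  | 0 => State.trivial
  | n + 1 => State.tensor (State.pow ρ n) ρ

/-! ## Classical-classical states and the relative entropy of discord -/

/-- The rank-one operator `|v⟩⟨v|`. -/
def ketBra {n : Type} [Fintype n] (v : EuclideanSpace ℂ n) : Matrix n n ℂ :=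
  Matrix.vecMulVec v.ofLp (star v.ofLp)

/-- The set of classical-classical states: the states
`∑ᵢⱼ pᵢⱼ |aᵢ⟩⟨aᵢ| ⊗ |bⱼ⟩⟨bⱼ|` with orthonormal bases `(aᵢ)` of `ℂ^A` and `(bⱼ)` of `ℂ^B` and a
probability distribution `p`. -/
def CC (S : BipartiteSystem) : Set (State S) :=
  {σ | ∃ (a : OrthonormalBasis S.A ℂ (EuclideanSpace ℂ S.A))
      (b : OrthonormalBasis S.B ℂ (EuclideanSpace ℂ S.B)) (p : S.A → S.B → ℝ),
      (∀ i j, 0 ≤ p i j) ∧ ∑ i, ∑ j, p i j = 1 ∧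
      σ.mat = ∑ i, ∑ j, (p i j : ℂ) • (ketBra (a i) ⊗ₖ ketBra (b j))}

/-- The relative entropy of discord `min_{σ ∈ CC} D(ρ‖σ)`. -/
def relDiscord {S : BipartiteSystem} (ρ : State S) : ℝ :=
  (⨅ σ ∈ CC S, relEntropy ρ σ).toReal

/-! ## Quantum operations -/

/-- The map `Φ ⊗ id` on `k × k` block matrices. -/
def ampliation {m n : Type} (Φ : Matrix m m ℂ →ₗ[ℂ] Matrix n n ℂ) (k : ℕ)
    (X : Matrix (m × Fin k) (m × Fin k) ℂ) : Matrix (n × Fin k) (n × Fin k) ℂ :=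
  Matrix.of fun x y => Φ (Matrix.of fun i j => X (i, x.2) (j, y.2)) x.1 y.1

/-- Quantum operations: completely positive and trace-preserving linear maps. -/
structure IsQuantumOperation {m n : Type} [Fintype m] [Fintype n]
    (Φ : Matrix m m ℂ →ₗ[ℂ] Matrix n n ℂ) : Prop where
  completelyPositive : ∀ (k : ℕ) (X : Matrix (m × Fin k) (m × Fin k) ℂ),
    X.PosSemidef → (ampliation Φ k X).PosSemidef
  tracePreserving : ∀ X, (Φ X).trace = X.trace

/-- The tensor product of two linear maps between operator spaces: the linear map with
`X ⊗ Y ↦ Φ X ⊗ Ψ Y`. -/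
def tensorMap {S S' T T' : BipartiteSystem} (Φ : Op S →ₗ[ℂ] Op S') (Ψ : Op T →ₗ[ℂ] Op T') :
    Op (S.tensor T) →ₗ[ℂ] Op (S'.tensor T') :=
  ∑ i : S.Idx, ∑ j : S.Idx, ∑ k : T.Idx, ∑ l : T.Idx,
    (Matrix.entryLinearMap ℂ ℂ (regroup S T (i, k)) (regroup S T (j, l)) :
      Op (S.tensor T) →ₗ[ℂ] ℂ).smulRight
      (tensorOp (Φ (Matrix.single i j 1)) (Ψ (Matrix.single k l 1)))

theorem tensorMap_tensorOp {S S' T T' : BipartiteSystem} (Φ : Op S →ₗ[ℂ] Op S')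
    (Ψ : Op T →ₗ[ℂ] Op T') (X : Op S) (Y : Op T) :
    tensorMap Φ Ψ (tensorOp X Y) = tensorOp (Φ X) (Ψ Y) := by
  have hX : Φ X = ∑ i, ∑ j, X i j • Φ (Matrix.single i j 1) := by
    conv_lhs => rw [Matrix.matrix_eq_sum_single X]
    simp only [map_sum, ← LinearMap.map_smul, Matrix.smul_single, smul_eq_mul, mul_one]
  have hY : Ψ Y = ∑ k, ∑ l, Y k l • Ψ (Matrix.single k l 1) := by
    conv_lhs => rw [Matrix.matrix_eq_sum_single Y]
    simp only [map_sum, ← LinearMap.map_smul, Matrix.smul_single, smul_eq_mul, mul_one]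
  ext x y
  rw [hX, hY]
  simp only [tensorMap, tensorOp, LinearMap.sum_apply, LinearMap.smulRight_apply,
    Matrix.entryLinearMap_apply, Matrix.reindex_apply, Matrix.submatrix_apply,
    Equiv.symm_apply_apply, Matrix.kroneckerMap_apply, Matrix.sum_apply, Matrix.smul_apply,
    smul_eq_mul, Finset.sum_mul]
  simp only [Finset.mul_sum]
  refine Finset.sum_congr rfl fun i _ => Finset.sum_congr rfl fun j _ =>
    Finset.sum_congr rfl fun k _ => Finset.sum_congr rfl fun l _ => ?_
  ring

/-! ## Resource theories, resource measures, conversion rates -/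

/-- A class of maps between the operator spaces of bipartite systems. -/
abbrev OpClass : Type 1 := ∀ S T : BipartiteSystem, Set (Op S →ₗ[ℂ] Op T)

/-- A class of free operations in a resource theory of discord: quantum operations that map
classical-classical states to classical-classical states. -/
structure IsFreeOperations (O : OpClass) : Prop where
  quantumOperation : ∀ S T, ∀ Φ ∈ O S T, IsQuantumOperation Φ
  preservesCC : ∀ S T, ∀ Φ ∈ O S T, ∀ σ ∈ CC S, ∃ τ ∈ CC T, Φ σ.mat = τ.mat

/-- The class contains the identity maps and is closed under tensor products. -/
structure IsTensorClosed (O : OpClass) : Prop where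
  id_mem : ∀ S, LinearMap.id ∈ O S S
  tensor_mem : ∀ S S' T T', ∀ Φ ∈ O S S', ∀ Ψ ∈ O T T',
    tensorMap Φ Ψ ∈ O (S.tensor T) (S'.tensor T')

/-- A family of real functions on the states of all bipartite systems. -/
abbrev Measure : Type 1 := ∀ S : BipartiteSystem, State S → ℝ

/-- Resource measures: families of real functions that do not increase under free operations. -/
def IsResourceMeasure (O : OpClass) (R : Measure) : Prop :=
  ∀ (S T : BipartiteSystem) (φ : State S) (ψ : State T),
    (∃ Φ ∈ O S T, Φ φ.mat = ψ.mat) → R T ψ ≤ R S φ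

/-- The rate `r` of the conversion of `φ` to `ψ` can be achieved asymptotically. -/
def IsAchievableRate (O : OpClass) {S T : BipartiteSystem} (φ : State S) (ψ : State T)
    (r : ℝ≥0) : Prop :=
  ∃ Φ : ∀ n : ℕ, Op (S.pow n) →ₗ[ℂ] Op (T.pow ⌈r * n⌉₊),
    (∀ n, 0 < n → Φ n ∈ O (S.pow n) (T.pow ⌈r * n⌉₊)) ∧
    liminf (fun n => traceNorm (Φ n (State.pow φ n).mat - (State.pow ψ ⌈r * n⌉₊).mat)) atTop = 0

/-- The rate of the asymptotic conversion of `φ` to `ψ`: the supremum of the achievable rates. -/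
def conversionRate (O : OpClass) {S T : BipartiteSystem} (φ : State S) (ψ : State T) : ℝ≥0∞ :=
  ⨆ (r : ℝ≥0) (_ : IsAchievableRate O φ ψ r), (r : ℝ≥0∞)

/-- Asymptotic consistency: `R(ψ) r(φ → ψ) ≤ R(φ)` for all states (with `0 · ∞ = 0`). -/
def IsConsistent (O : OpClass) (R : Measure) : Prop :=
  ∀ (S T : BipartiteSystem) (φ : State S) (ψ : State T),
    (R T ψ : EReal) * (conversionRate O φ ψ : EReal) ≤ (R S φ : EReal)

/-- Asymptotic continuity of a family of functions. -/
def IsAsymptoticallyContinuous (R : Measure) : Prop :=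
  ∀ (S : BipartiteSystem) (n : ℕ → ℕ), (∀ i, 0 < n i) →
    ∀ φ ψ : ∀ i, State (S.pow (n i)),
      Tendsto (fun i => traceNorm ((φ i).mat - (ψ i).mat)) atTop (𝓝 0) →
      Tendsto (fun i => |R (S.pow (n i)) (φ i) - R (S.pow (n i)) (ψ i)| / n i) atTop (𝓝 0)

/-- The regularization `R^∞(φ) = lim R(φ^{⊗ n}) / n`. -/
def regularization (R : Measure) : Measure := fun S φ =>
  limUnder atTop fun n : ℕ => R (S.pow n) (State.pow φ n) / n

end Discord

end

noncomputable section

namespace Discord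

set_option linter.unusedSectionVars false

/-! ## Weighted divergences and their rational approximants -/

/-! For `ρ` with eigenpairs `(pᵢ, uᵢ)` and `σ` with eigenpairs `(qⱼ, vⱼ)`, the relative entropy is,
up to the factor `log 2`, the weighted scalar sum of `p (log p - log q)` over pairs `(j, i)` with
weights `|⟨vⱼ, uᵢ⟩|²`. Each scalar term is the renormalised integral over `t` of `p² / (q + t p)`,
so two such sums with equal total mass can be compared through their quasi-entropies at every `t >
0` (`divSum_le_of_quasiSum_le`). A quasi-entropy is the maximum over matrices `X` of `quasiForm t ρ
σ X`, which is linear in `(ρ, σ)`. This variational formula yields three facts: monotonicity under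
quantum operations (through a Schwarz inequality for the adjoint map), convexity of the entropy gap,
and the operator monotonicity of the logarithm needed for subadditivity of the entropy.

Among the states diagonal in a fixed product basis `W`, the closest one to `φ` is `φ` dephased in
`W`, at a distance equal to the entropy gap `S(diag_W φ) - S(φ)`. Hence the discord is a minimum of
entropy gaps over the compact set of local bases (`isLeast_relEntropy_of_min`), and it decreases
under free operations by monotonicity of the relative entropy.

For continuity, write `ψ + P = φ + N` with `P, N ≥ 0` of trace `ε = ‖φ - ψ‖₁ / 2`. The gap is
subadditive (`entropyGap_add_le`) and superadditive up to a scalar correction (`le_entropyGap_add`).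
Evaluating both at the common sum bounds the difference of the gaps of `ψ` and `φ` in one fixed
basis, and the basis optimal for `φ` gives the bound for the discord.

Products of local bases make the discord subadditive on tensor powers, so Fekete's lemma gives the
regularization. Consistency combines monotonicity, the continuity bound per copy, and the ratio
`⌈rn⌉ / n → r` (`IsAchievableRate.mul_le`). -/

/-- The weighted sum of the quasi-entropies `p² / (q + t p)`. -/
def quasiSum {K : Type*} [Fintype K] (m p q : K → ℝ) (t : ℝ) : ℝ :=
  ∑ k, m k * (p k ^ 2 / (q k + t * p k))

/-- The weighted sum of the divergences `p (log p - log q)`. -/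
def divSum {K : Type*} [Fintype K] (m p q : K → ℝ) : ℝ :=
  ∑ k, m k * p k * (Real.log (p k) - Real.log (q k))

section Scalar

variable {K L : Type*} [Fintype K] [Fintype L] {m p q : K → ℝ} {m' p' q' : L → ℝ}

/-- The point is a bound that does not depend on `t`. -/
theorem quasiSum_le (hm : ∀ k, 0 ≤ m k) (hp : ∀ k, 0 ≤ p k) (hq : ∀ k, 0 ≤ q k)
    (hs : ∀ k, q k = 0 → m k * p k = 0) {t : ℝ} (ht : 0 < t) :
    quasiSum m p q t ≤ ∑ k, m k * (p k ^ 2 / q k) := by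
  refine Finset.sum_le_sum fun k _ => ?_
  rcases (hq k).eq_or_lt with h | h
  · rcases mul_eq_zero.1 (hs k h.symm) with h' | h' <;> simp [h']
  · have := mul_nonneg ht.le (hp k)
    exact mul_le_mul_of_nonneg_left
      (div_le_div_of_nonneg_left (sq_nonneg _) h (by linarith)) (hm k)

/-- A violating index contributes `m' p' / t`, which blows up as `t → 0`, while the right-hand side
stays bounded by `quasiSum_le`. -/
theorem support_of_quasiSum_le (hm : ∀ k, 0 ≤ m k) (hp : ∀ k, 0 ≤ p k) (hq : ∀ k, 0 ≤ q k)
    (hm' : ∀ k, 0 ≤ m' k) (hp' : ∀ k, 0 ≤ p' k) (hq' : ∀ k, 0 ≤ q' k)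
    (hs : ∀ k, q k = 0 → m k * p k = 0)
    (hle : ∀ t, 0 < t → quasiSum m' p' q' t ≤ quasiSum m p q t) :
    ∀ k, q' k = 0 → m' k * p' k = 0 := by
  intro k hk
  by_contra hne
  have hpos : 0 < m' k * p' k := lt_of_le_of_ne (mul_nonneg (hm' k) (hp' k)) (Ne.symm hne)
  have hp0 : p' k ≠ 0 := right_ne_zero_of_mul hne
  set C := ∑ k, m k * (p k ^ 2 / q k) with hC
  have hC0 : 0 ≤ C := Finset.sum_nonneg fun k _ =>
    mul_nonneg (hm k) (div_nonneg (sq_nonneg _) (hq k))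
  -- At this value of `t` the violating term is exactly `C + 1`.
  have ht : 0 < m' k * p' k / (C + 1) := by positivity
  have h1 := (hle _ ht).trans (quasiSum_le hm hp hq hs ht)
  have h2 : m' k * (p' k ^ 2 / (q' k + m' k * p' k / (C + 1) * p' k)) ≤
      quasiSum m' p' q' (m' k * p' k / (C + 1)) :=
    Finset.single_le_sum (f := fun k' => m' k' * (p' k' ^ 2 /
      (q' k' + m' k * p' k / (C + 1) * p' k')))
      (fun j _ => mul_nonneg (hm' j) (div_nonneg (sq_nonneg _)
        (add_nonneg (hq' j) (mul_nonneg ht.le (hp' j))))) (Finset.mem_univ k)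
  have h3 : m' k * (p' k ^ 2 / (q' k + m' k * p' k / (C + 1) * p' k)) = C + 1 := by
    have hm0 : m' k ≠ 0 := left_ne_zero_of_mul hne
    have : C + 1 ≠ 0 := by positivity
    rw [hk]
    field_simp
    simp
  linarith

/-- The primitive of `quasiSum`. -/
def quasiPrim (m p q : K → ℝ) (T : ℝ) : ℝ :=
  ∑ k, m k * p k * (Real.log (q k + T * p k) - Real.log (q k))

theorem hasDerivAt_quasiPrim (hp : ∀ k, 0 ≤ p k) (hq : ∀ k, 0 ≤ q k)
    (hs : ∀ k, q k = 0 → m k * p k = 0) {T : ℝ} (hT : 0 ≤ T) :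
    HasDerivAt (quasiPrim m p q) (quasiSum m p q T) T := by
  unfold quasiPrim quasiSum
  refine HasDerivAt.fun_sum fun k _ => ?_
  by_cases h : m k * p k = 0
  · have : m k * (p k ^ 2 / (q k + T * p k)) = 0 := by
      rcases mul_eq_zero.1 h with h | h <;> simp [h]
    rw [this]
    simpa [h] using hasDerivAt_const T (0 : ℝ)
  · have hq0 : 0 < q k := lt_of_le_of_ne (hq k) fun h0 => h (hs k h0.symm)
    have hpos : 0 < q k + T * p k := by have := mul_nonneg hT (hp k); linarith
    have h1 : HasDerivAt (fun T => q k + T * p k) (p k) T := by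
      simpa using ((hasDerivAt_id T).mul_const (p k)).const_add (q k)
    have h2 := ((h1.log hpos.ne').sub_const (Real.log (q k))).const_mul (m k * p k)
    exact h2.congr_deriv (by ring)

/-- Since `log (q + T p) = log T + log (q / T + p)`, subtracting the mass times `log T` leaves a
convergent expression, in which `q / T → 0`. -/
theorem tendsto_quasiPrim (hp : ∀ k, 0 ≤ p k) (hq : ∀ k, 0 ≤ q k)
    (hs : ∀ k, q k = 0 → m k * p k = 0) :
    Tendsto (fun T => quasiPrim m p q T - (∑ k, m k * p k) * Real.log T) atTop
      (𝓝 (divSum m p q)) := by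
  have h : Tendsto (fun T => ∑ k, m k * p k * (Real.log (q k / T + p k) - Real.log (q k))) atTop
      (𝓝 (divSum m p q)) := by
    refine tendsto_finsetSum _ fun k _ => ?_
    by_cases h : m k * p k = 0
    · simp [h]
    · have hp0 : p k ≠ 0 := right_ne_zero_of_mul h
      have h1 : Tendsto (fun T : ℝ => q k / T + p k) atTop (𝓝 (p k)) := by
        simpa using (tendsto_const_nhds.div_atTop tendsto_id : Tendsto (fun T : ℝ => q k / T)
          atTop (𝓝 0)).add_const (p k)
      exact ((h1.log hp0).sub_const _).const_mul _
  refine h.congr' ?_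
  filter_upwards [eventually_gt_atTop 0] with T hT
  rw [quasiPrim, Finset.sum_mul, ← Finset.sum_sub_distrib]
  refine Finset.sum_congr rfl fun k _ => ?_
  by_cases h : m k * p k = 0
  · simp [h]
  · have hq0 : 0 < q k := lt_of_le_of_ne (hq k) fun h0 => h (hs k h0.symm)
    have hpos : 0 < q k / T + p k := by have := hp k; positivity
    have : q k + T * p k = T * (q k / T + p k) := by field_simp
    rw [this, Real.log_mul hT.ne' hpos.ne']
    ring

/-- Integrate the inequality over `[0, T]` and let `T → ∞`. The divergent parts `log T` cancel
because the total masses agree. -/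
theorem divSum_le_of_quasiSum_le (hp : ∀ k, 0 ≤ p k) (hq : ∀ k, 0 ≤ q k)
    (hp' : ∀ k, 0 ≤ p' k) (hq' : ∀ k, 0 ≤ q' k)
    (hs : ∀ k, q k = 0 → m k * p k = 0) (hs' : ∀ k, q' k = 0 → m' k * p' k = 0)
    (hsum : ∑ k, m' k * p' k = ∑ k, m k * p k)
    (hle : ∀ t, 0 < t → quasiSum m' p' q' t ≤ quasiSum m p q t) :
    divSum m' p' q' ≤ divSum m p q := by
  refine le_of_tendsto_of_tendsto (tendsto_quasiPrim hp' hq' hs') (tendsto_quasiPrim hp hq hs) ?_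
  filter_upwards [eventually_ge_atTop 0] with T hT
  rw [hsum]
  refine sub_le_sub_right ?_ _
  have hd : ∀ T, 0 ≤ T → HasDerivAt (fun T => quasiPrim m p q T - quasiPrim m' p' q' T)
      (quasiSum m p q T - quasiSum m' p' q' T) T := fun T hT =>
    (hasDerivAt_quasiPrim hp hq hs hT).sub (hasDerivAt_quasiPrim hp' hq' hs' hT)
  have hmono : MonotoneOn (fun T => quasiPrim m p q T - quasiPrim m' p' q' T) (Set.Ici 0) := by
    refine monotoneOn_of_deriv_nonneg (convex_Ici 0)
      (fun T hT => (hd T hT).continuousAt.continuousWithinAt) ?_ ?_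
    · intro T hT
      exact (hd T (interior_subset hT)).differentiableAt.differentiableWithinAt
    · intro T hT
      rw [interior_Ici] at hT
      rw [(hd T (le_of_lt hT)).deriv]
      exact sub_nonneg.2 (hle T hT)
  have := hmono (Set.mem_Ici.2 le_rfl) (Set.mem_Ici.2 hT) hT
  simp only [quasiPrim, zero_mul, add_zero, sub_self, mul_zero, Finset.sum_const_zero] at this
  simpa [quasiPrim] using this

/-- Termwise `log x ≤ x - 1` at `x = q / p`. With equal total masses this is the nonnegativity of
the divergence. -/
theorem divSum_ge (hm : ∀ k, 0 ≤ m k) (hp : ∀ k, 0 ≤ p k) (hq : ∀ k, 0 ≤ q k)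
    (hs : ∀ k, q k = 0 → m k * p k = 0) :
    ∑ k, m k * (p k - q k) ≤ divSum m p q := by
  refine Finset.sum_le_sum fun k _ => ?_
  by_cases h : m k * p k = 0
  · rw [h, mul_sub, h]
    have := mul_nonneg (hm k) (hq k)
    linarith
  · have hq0 : 0 < q k := lt_of_le_of_ne (hq k) fun h0 => h (hs k h0.symm)
    have hp0 : 0 < p k := lt_of_le_of_ne (hp k) (Ne.symm (right_ne_zero_of_mul h))
    have h1 := Real.log_le_sub_one_of_pos (div_pos hq0 hp0)
    rw [Real.log_div hq0.ne' hp0.ne'] at h1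
    have h2 : p k * (Real.log (q k) - Real.log (p k)) ≤ q k - p k := by
      refine (mul_le_mul_of_nonneg_left h1 hp0.le).trans (le_of_eq ?_)
      field_simp
    have := mul_le_mul_of_nonneg_left h2 (hm k)
    nlinarith

end Scalar

/-! ## Operators in diagonal form -/

section Diag

open Matrix

variable {n : Type} [Fintype n] [DecidableEq n]

/-- The Hermitian matrix with eigenvalues `p` and eigenvectors the columns of `U`. -/
def diagConj (U : Matrix n n ℂ) (p : n → ℝ) : Matrix n n ℂ :=
  U * diagonal (fun i => (p i : ℂ)) * Uᴴ

/-- The squared overlaps of the columns of `V` and `U`. -/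
def overlap (V U : Matrix n n ℂ) : n × n → ℝ := fun x => Complex.normSq ((Vᴴ * U) x.1 x.2)

theorem overlap_nonneg (V U : Matrix n n ℂ) (x : n × n) : 0 ≤ overlap V U x :=
  Complex.normSq_nonneg _

theorem conjTranspose_mul_self_of_mem {U : Matrix n n ℂ} (hU : U ∈ unitaryGroup n ℂ) :
    Uᴴ * U = 1 := mem_unitaryGroup_iff'.1 hU

theorem mul_conjTranspose_self_of_mem {U : Matrix n n ℂ} (hU : U ∈ unitaryGroup n ℂ) :
    U * Uᴴ = 1 := mem_unitaryGroup_iff.1 hU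

theorem conjTranspose_mem {U : Matrix n n ℂ} (hU : U ∈ unitaryGroup n ℂ) :
    Uᴴ ∈ unitaryGroup n ℂ :=
  mem_unitaryGroup_iff.2 (by
    rw [star_eq_conjTranspose, conjTranspose_conjTranspose, conjTranspose_mul_self_of_mem hU])

theorem sum_normSq_col {W : Matrix n n ℂ} (hW : W ∈ unitaryGroup n ℂ) (i : n) :
    ∑ j, Complex.normSq (W j i) = 1 := by
  have h := congrFun (congrFun (conjTranspose_mul_self_of_mem hW) i) i
  rw [mul_apply, one_apply_eq] at h
  have : ((∑ j, Complex.normSq (W j i) : ℝ) : ℂ) = 1 := by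
    rw [← h]
    push_cast
    exact Finset.sum_congr rfl fun j _ => by
      rw [conjTranspose_apply, Complex.normSq_eq_conj_mul_self]; rfl
  exact_mod_cast this

theorem sum_overlap_left {U V : Matrix n n ℂ} (hU : U ∈ unitaryGroup n ℂ)
    (hV : V ∈ unitaryGroup n ℂ) (i : n) : ∑ j, overlap V U (j, i) = 1 :=
  sum_normSq_col (mul_mem (conjTranspose_mem hV) hU) i

theorem overlap_comm (U V : Matrix n n ℂ) (i j : n) : overlap V U (j, i) = overlap U V (i, j) := by
  have : (Vᴴ * U) j i = star ((Uᴴ * V) i j) := by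
    rw [← conjTranspose_apply, conjTranspose_mul, conjTranspose_conjTranspose]
  simp only [overlap]
  rw [this]
  exact Complex.normSq_conj _

theorem sum_overlap_right {U V : Matrix n n ℂ} (hU : U ∈ unitaryGroup n ℂ)
    (hV : V ∈ unitaryGroup n ℂ) (j : n) : ∑ i, overlap V U (j, i) = 1 := by
  simp only [overlap_comm U V]
  exact sum_overlap_left hV hU j

/-- The quadratic form whose supremum over `X` is a quasi-entropy of `ρ` and `σ`. -/
def quasiForm (t : ℝ) (ρ σ X : Matrix n n ℂ) : ℝ :=
  2 * (Xᴴ * ρ).trace.re - (Xᴴ * σ * X).trace.re - t * (X * ρ * Xᴴ).trace.re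

theorem trace_conjTranspose_diagonal (Y : Matrix n n ℂ) (q : n → ℝ) :
    (Yᴴ * diagonal (fun j => (q j : ℂ)) * Y).trace.re
      = ∑ x : n × n, q x.1 * Complex.normSq (Y x.1 x.2) := by
  rw [Fintype.sum_prod_type_right, trace, Complex.re_sum]
  refine Finset.sum_congr rfl fun i _ => ?_
  rw [diag_apply, mul_apply, Complex.re_sum]
  refine Finset.sum_congr rfl fun j _ => ?_
  rw [mul_diagonal, conjTranspose_apply, Complex.normSq_apply]
  simp
  ring

theorem trace_diagonal_conjTranspose (Y : Matrix n n ℂ) (p : n → ℝ) :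
    (Y * diagonal (fun j => (p j : ℂ)) * Yᴴ).trace.re
      = ∑ x : n × n, p x.2 * Complex.normSq (Y x.1 x.2) := by
  rw [Fintype.sum_prod_type, trace, Complex.re_sum]
  refine Finset.sum_congr rfl fun i _ => ?_
  rw [diag_apply, mul_apply, Complex.re_sum]
  refine Finset.sum_congr rfl fun j _ => ?_
  rw [mul_diagonal, conjTranspose_apply, Complex.normSq_apply]
  simp
  ring

/-- The substitution `X = V Y Uᴴ` decouples the form into one scalar quadratic for each entry of
`Y`. -/
theorem quasiForm_diagConj {U V : Matrix n n ℂ} (hU : U ∈ unitaryGroup n ℂ)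
    (hV : V ∈ unitaryGroup n ℂ) (p q : n → ℝ) (t : ℝ) (Y : Matrix n n ℂ) :
    quasiForm t (diagConj U p) (diagConj V q) (V * Y * Uᴴ) =
      ∑ x : n × n, (2 * p x.2 * (star (Y x.1 x.2) * (Vᴴ * U) x.1 x.2).re
        - (q x.1 + t * p x.2) * Complex.normSq (Y x.1 x.2)) := by
  have hU1 := conjTranspose_mul_self_of_mem hU
  have hV1 := conjTranspose_mul_self_of_mem hV
  set P : Matrix n n ℂ := diagonal (fun i => (p i : ℂ)) with hP
  set Q : Matrix n n ℂ := diagonal (fun i => (q i : ℂ)) with hQ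
  have h1 : ((V * Y * Uᴴ)ᴴ * diagConj U p).trace = (Yᴴ * ((Vᴴ * U) * P)).trace := by
    have : (V * Y * Uᴴ)ᴴ * diagConj U p = U * (Yᴴ * ((Vᴴ * U) * P) * Uᴴ) := by
      simp only [diagConj, conjTranspose_mul, conjTranspose_conjTranspose, Matrix.mul_assoc, hP]
    rw [this, trace_mul_comm, Matrix.mul_assoc, hU1, Matrix.mul_one]
  have h2 : ((V * Y * Uᴴ)ᴴ * diagConj V q * (V * Y * Uᴴ)).trace = (Yᴴ * Q * Y).trace := by
    have : (V * Y * Uᴴ)ᴴ * diagConj V q * (V * Y * Uᴴ)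
        = U * (Yᴴ * (Vᴴ * V) * Q * (Vᴴ * V) * Y * Uᴴ) := by
      simp only [diagConj, conjTranspose_mul, conjTranspose_conjTranspose, Matrix.mul_assoc, hQ]
    rw [this, trace_mul_comm, Matrix.mul_assoc, hU1, hV1, Matrix.mul_one, Matrix.mul_one,
      Matrix.mul_one]
  have h3 : ((V * Y * Uᴴ) * diagConj U p * (V * Y * Uᴴ)ᴴ).trace = (Y * P * Yᴴ).trace := by
    have : (V * Y * Uᴴ) * diagConj U p * (V * Y * Uᴴ)ᴴ
        = V * (Y * (Uᴴ * U) * P * (Uᴴ * U) * Yᴴ * Vᴴ) := by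
      simp only [diagConj, conjTranspose_mul, conjTranspose_conjTranspose, Matrix.mul_assoc, hP]
    rw [this, trace_mul_comm, Matrix.mul_assoc, hU1, hV1, Matrix.mul_one, Matrix.mul_one,
      Matrix.mul_one]
  have h4 : (Yᴴ * ((Vᴴ * U) * P)).trace.re
      = ∑ x : n × n, p x.2 * (star (Y x.1 x.2) * (Vᴴ * U) x.1 x.2).re := by
    rw [Fintype.sum_prod_type_right, trace, Complex.re_sum]
    refine Finset.sum_congr rfl fun i _ => ?_
    rw [diag_apply, mul_apply, Complex.re_sum]
    refine Finset.sum_congr rfl fun j _ => ?_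
    rw [hP, mul_diagonal, conjTranspose_apply, ← mul_assoc, mul_comm, Complex.re_ofReal_mul]
  rw [quasiForm, h1, h2, h3, h4, hP, hQ, trace_conjTranspose_diagonal,
    trace_diagonal_conjTranspose, Finset.mul_sum, Finset.mul_sum, ← Finset.sum_sub_distrib,
    ← Finset.sum_sub_distrib]
  exact Finset.sum_congr rfl fun x _ => by ring

/-- Complete the square in each entry: `2 p Re (ȳ w) - s |y|² ≤ p² |w|² / s` with `s = q + t p`. -/
theorem quasiForm_le {U V : Matrix n n ℂ} (hU : U ∈ unitaryGroup n ℂ)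
    (hV : V ∈ unitaryGroup n ℂ) {p q : n → ℝ} (hp : ∀ i, 0 ≤ p i) (hq : ∀ i, 0 ≤ q i)
    {t : ℝ} (ht : 0 < t) (X : Matrix n n ℂ) :
    quasiForm t (diagConj U p) (diagConj V q) X ≤
      quasiSum (overlap V U) (fun x => p x.2) (fun x => q x.1) t := by
  have hX : X = V * (Vᴴ * X * U) * Uᴴ := by
    have : V * (Vᴴ * X * U) * Uᴴ = (V * Vᴴ) * X * (U * Uᴴ) := by simp only [Matrix.mul_assoc]
    rw [this, mul_conjTranspose_self_of_mem hU, mul_conjTranspose_self_of_mem hV,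
      Matrix.one_mul, Matrix.mul_one]
  rw [hX, quasiForm_diagConj hU hV]
  refine Finset.sum_le_sum fun x _ => ?_
  generalize (Vᴴ * X * U) x.1 x.2 = y
  simp only [overlap]
  generalize (Vᴴ * U) x.1 x.2 = w
  -- For `p = 0` the denominator may vanish, but then the linear term is absent.
  rcases (hp x.2).eq_or_lt with h | h
  · rw [← h]
    have := mul_nonneg (hq x.1) (Complex.normSq_nonneg y)
    simp
    linarith
  · have hs : 0 < q x.1 + t * p x.2 := by have := hq x.1; positivity
    set s := q x.1 + t * p x.2
    rw [mul_div_assoc', le_div_iff₀ hs]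
    simp only [Complex.normSq_apply, Complex.mul_re, Complex.star_def, Complex.conj_re,
      Complex.conj_im]
    nlinarith [sq_nonneg (s * y.re - p x.2 * w.re), sq_nonneg (s * y.im - p x.2 * w.im)]

theorem exists_quasiForm_eq {U V : Matrix n n ℂ} (hU : U ∈ unitaryGroup n ℂ)
    (hV : V ∈ unitaryGroup n ℂ) {p q : n → ℝ} (hp : ∀ i, 0 ≤ p i) (hq : ∀ i, 0 ≤ q i)
    {t : ℝ} (ht : 0 < t) :
    ∃ X, quasiForm t (diagConj U p) (diagConj V q) X =
      quasiSum (overlap V U) (fun x => p x.2) (fun x => q x.1) t := by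
  -- The entries `p w / (q + t p)` are those that make the completed squares vanish.
  refine ⟨V * (of fun j i => ((p i / (q j + t * p i) : ℝ) : ℂ) * (Vᴴ * U) j i) * Uᴴ, ?_⟩
  rw [quasiForm_diagConj hU hV]
  refine Finset.sum_congr rfl fun x _ => ?_
  simp only [overlap, of_apply]
  generalize (Vᴴ * U) x.1 x.2 = w
  rcases (hp x.2).eq_or_lt with h | h
  · simp [← h]
  · have hs : 0 < q x.1 + t * p x.2 := by have := hq x.1; positivity
    set s := q x.1 + t * p x.2
    simp only [Complex.normSq_apply, Complex.mul_re, Complex.star_def, Complex.conj_re,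
      Complex.conj_im, Complex.mul_im, Complex.ofReal_re, Complex.ofReal_im]
    field_simp
    ring

theorem diagConj_eigen {M : Matrix n n ℂ} (hM : M.IsHermitian) :
    M = diagConj (hM.eigenvectorUnitary : Matrix n n ℂ) hM.eigenvalues := by
  conv_lhs => rw [hM.spectral_theorem, Unitary.conjStarAlgAut_apply]
  rfl

theorem PosSemidef.exists_diagConj {M : Matrix n n ℂ} (hM : M.PosSemidef) :
    ∃ U ∈ unitaryGroup n ℂ, ∃ p : n → ℝ, (∀ i, 0 ≤ p i) ∧ M = diagConj U p :=
  ⟨_, hM.1.eigenvectorUnitary.2, _, hM.eigenvalues_nonneg, diagConj_eigen hM.1⟩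

theorem conj_eq_iff {U V A B : Matrix n n ℂ} (hU : U ∈ unitaryGroup n ℂ)
    (hV : V ∈ unitaryGroup n ℂ) : V * A * Vᴴ = U * B * Uᴴ ↔ A * (Vᴴ * U) = (Vᴴ * U) * B := by
  have hU1 := conjTranspose_mul_self_of_mem hU
  have hV1 := conjTranspose_mul_self_of_mem hV
  have hU2 := mul_conjTranspose_self_of_mem hU
  have hV2 := mul_conjTranspose_self_of_mem hV
  constructor
  · intro h
    have h2 : Vᴴ * (V * A * Vᴴ) * U = Vᴴ * (U * B * Uᴴ) * U := by rw [h]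
    have e1 : Vᴴ * (V * A * Vᴴ) * U = (Vᴴ * V) * (A * (Vᴴ * U)) := by simp only [Matrix.mul_assoc]
    have e2 : Vᴴ * (U * B * Uᴴ) * U = (Vᴴ * U) * B * (Uᴴ * U) := by simp only [Matrix.mul_assoc]
    rw [e1, e2, hU1, hV1, Matrix.one_mul, Matrix.mul_one] at h2
    exact h2
  · intro h
    have h2 : V * (A * (Vᴴ * U)) * Uᴴ = V * ((Vᴴ * U) * B) * Uᴴ := by rw [h]
    have e1 : V * (A * (Vᴴ * U)) * Uᴴ = V * A * Vᴴ * (U * Uᴴ) := by simp only [Matrix.mul_assoc]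
    have e2 : V * ((Vᴴ * U) * B) * Uᴴ = (V * Vᴴ) * (U * B * Uᴴ) := by simp only [Matrix.mul_assoc]
    rw [e1, e2, hU2, hV2, Matrix.one_mul, Matrix.mul_one] at h2
    exact h2

/-- The unitary `Vᴴ U` intertwines the two diagonal matrices, so `q i = p j` wherever its `(i, j)`
entry is nonzero, and it intertwines their images under `f` as well. Functional calculus may thus be
computed in any diagonalization. -/
theorem diagConj_comp {U V : Matrix n n ℂ} (hU : U ∈ unitaryGroup n ℂ)
    (hV : V ∈ unitaryGroup n ℂ) {p q : n → ℝ} (h : diagConj V q = diagConj U p) (f : ℝ → ℝ) :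
    diagConj V (f ∘ q) = diagConj U (f ∘ p) := by
  have h1 := (conj_eq_iff hU hV).1 h
  refine (conj_eq_iff hU hV).2 ?_
  ext i j
  have h2 := congrFun (congrFun h1 i) j
  rw [diagonal_mul, mul_diagonal] at h2 ⊢
  by_cases hw : (Vᴴ * U) i j = 0
  · simp [hw]
  · have : q i = p j := by
      have : (q i : ℂ) = p j := mul_right_cancel₀ hw (h2.trans (mul_comm _ _))
      exact_mod_cast this
    simp [this, mul_comm]

theorem cfc_eq_diagConj {M : Matrix n n ℂ} (hM : M.IsHermitian) {U : Matrix n n ℂ}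
    (hU : U ∈ unitaryGroup n ℂ) {p : n → ℝ} (h : M = diagConj U p) (f : ℝ → ℝ) :
    hM.cfc f = diagConj U (f ∘ p) := by
  rw [← diagConj_comp hU hM.eigenvectorUnitary.2 ((diagConj_eigen hM).symm.trans h) f,
    IsHermitian.cfc, Unitary.conjStarAlgAut_apply]
  rfl

theorem diagConj_mul {U : Matrix n n ℂ} (hU : U ∈ unitaryGroup n ℂ) (p g : n → ℝ) :
    diagConj U p * diagConj U g = diagConj U (fun i => p i * g i) := by
  have : diagConj U p * diagConj U g = U * (diagonal (fun i => (p i : ℂ)) * (Uᴴ * U) *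
      diagonal (fun i => (g i : ℂ))) * Uᴴ := by simp only [diagConj, Matrix.mul_assoc]
  rw [this, conjTranspose_mul_self_of_mem hU, Matrix.mul_one, diagonal_mul_diagonal]
  simp [diagConj]

theorem trace_diagConj {U : Matrix n n ℂ} (hU : U ∈ unitaryGroup n ℂ) (p : n → ℝ) :
    (diagConj U p).trace = ((∑ i, p i : ℝ) : ℂ) := by
  rw [diagConj, Matrix.mul_assoc, trace_mul_comm, Matrix.mul_assoc,
    conjTranspose_mul_self_of_mem hU, Matrix.mul_one, trace_diagonal]
  push_cast
  rfl

theorem trace_diagConj_mul (U V : Matrix n n ℂ) (p g : n → ℝ) :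
    (diagConj U p * diagConj V g).trace.re
      = ∑ x, overlap V U x * p x.2 * g x.1 := by
  have : (diagConj U p * diagConj V g).trace = (diagonal (fun i => (g i : ℂ)) *
      ((Vᴴ * U) * diagonal (fun i => (p i : ℂ)) * (Vᴴ * U)ᴴ)).trace := by
    rw [diagConj, diagConj, ← Matrix.mul_assoc, trace_mul_comm, ← Matrix.mul_assoc,
      ← Matrix.mul_assoc, trace_mul_comm, conjTranspose_mul, conjTranspose_conjTranspose]
    simp only [Matrix.mul_assoc]
  rw [this, Fintype.sum_prod_type, trace, Complex.re_sum]
  refine Finset.sum_congr rfl fun j _ => ?_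
  rw [diag_apply, diagonal_mul, mul_apply, Finset.mul_sum, Complex.re_sum]
  refine Finset.sum_congr rfl fun i _ => ?_
  rw [mul_diagonal, conjTranspose_apply, overlap, Complex.normSq_apply]
  simp
  ring

theorem sum_overlap_mul_left {U V : Matrix n n ℂ} (hU : U ∈ unitaryGroup n ℂ)
    (hV : V ∈ unitaryGroup n ℂ) (f : n → ℝ) : ∑ x, overlap V U x * f x.2 = ∑ i, f i := by
  rw [Fintype.sum_prod_type_right]
  refine Finset.sum_congr rfl fun i _ => ?_
  dsimp only
  rw [← Finset.sum_mul, sum_overlap_left hU hV, one_mul]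

theorem sum_overlap_mul_right {U V : Matrix n n ℂ} (hU : U ∈ unitaryGroup n ℂ)
    (hV : V ∈ unitaryGroup n ℂ) (f : n → ℝ) : ∑ x, overlap V U x * f x.1 = ∑ i, f i := by
  rw [Fintype.sum_prod_type]
  refine Finset.sum_congr rfl fun i _ => ?_
  dsimp only
  rw [← Finset.sum_mul, sum_overlap_right hU hV, one_mul]

theorem divSum_overlap {U V : Matrix n n ℂ} (hU : U ∈ unitaryGroup n ℂ)
    (hV : V ∈ unitaryGroup n ℂ) (p q : n → ℝ) :
    divSum (overlap V U) (fun x => p x.2) (fun x => q x.1) =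
      ∑ i, p i * Real.log (p i) - ∑ x, overlap V U x * p x.2 * Real.log (q x.1) := by
  rw [← sum_overlap_mul_left hU hV, ← Finset.sum_sub_distrib]
  exact Finset.sum_congr rfl fun x _ => by ring

theorem overlap_mul_eq_zero_iff {U V : Matrix n n ℂ} {p : n → ℝ} {x : n × n} :
    overlap V U x * p x.2 = 0 ↔ (Vᴴ * U) x.1 x.2 * p x.2 = 0 := by
  simp [overlap]

/-- Both sides say that `pᵢ uᵢ` has no component along the eigenvectors `vⱼ` in the kernel of
`diagConj V q`. -/
theorem supp_le_supp_iff {U V : Matrix n n ℂ} (hU : U ∈ unitaryGroup n ℂ)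
    (hV : V ∈ unitaryGroup n ℂ) (p q : n → ℝ) :
    supp (diagConj U p) ≤ supp (diagConj V q) ↔
      ∀ x : n × n, q x.1 = 0 → overlap V U x * p x.2 = 0 := by
  have key : ∀ j i, (Vᴴ * diagConj U p * U) j i = (Vᴴ * U) j i * p i := by
    intro j i
    have : Vᴴ * diagConj U p * U = (Vᴴ * U) * diagonal (fun i => (p i : ℂ)) * (Uᴴ * U) := by
      simp only [diagConj, Matrix.mul_assoc]
    rw [this, conjTranspose_mul_self_of_mem hU, Matrix.mul_one, mul_diagonal]
  constructor
  · rintro h ⟨j, i⟩ hq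
    rw [overlap_mul_eq_zero_iff]
    dsimp only at hq ⊢
    rw [← key]
    have h1 : diagConj U p *ᵥ (U.col i) ∈ supp (diagConj U p) := ⟨U.col i, rfl⟩
    obtain ⟨z, hz⟩ := h h1
    have h2 : (Vᴴ * diagConj U p * U) j i = (Vᴴ *ᵥ (diagConj U p *ᵥ U.col i)) j := by
      rw [mulVec_mulVec]
      rfl
    have h3 : Vᴴ * diagConj V q = diagonal (fun i => (q i : ℂ)) * Vᴴ := by
      have : Vᴴ * diagConj V q = (Vᴴ * V) * diagonal (fun i => (q i : ℂ)) * Vᴴ := by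
        simp only [diagConj, Matrix.mul_assoc]
      rw [this, conjTranspose_mul_self_of_mem hV, Matrix.one_mul]
    rw [h2, ← hz, mulVecLin_apply, mulVec_mulVec, h3, ← mulVec_mulVec, mulVec_diagonal, hq]
    simp
  · rintro h _ ⟨x, rfl⟩
    -- Factor through the pseudo-inverse: with `0⁻¹ = 0`, the product `q q⁻¹` is the indicator of
    -- the support.
    have hfac : diagConj U p = diagConj V q * (diagConj V (fun j => (q j)⁻¹) * diagConj U p) := by
      rw [← Matrix.mul_assoc, diagConj_mul hV]
      have e1 : diagConj V (fun i => q i * (q i)⁻¹) * diagConj U p =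
          V * (diagonal (fun i => ((q i * (q i)⁻¹ : ℝ) : ℂ)) * (Vᴴ * diagConj U p * U)) * Uᴴ := by
        have : V * (diagonal (fun i => ((q i * (q i)⁻¹ : ℝ) : ℂ)) * (Vᴴ * diagConj U p * U)) * Uᴴ
          = V * diagonal (fun i => ((q i * (q i)⁻¹ : ℝ) : ℂ)) * Vᴴ * diagConj U p * (U * Uᴴ) := by
            simp only [Matrix.mul_assoc]
        rw [this, mul_conjTranspose_self_of_mem hU, Matrix.mul_one]
        rfl
      have e2 : diagonal (fun i => ((q i * (q i)⁻¹ : ℝ) : ℂ)) * (Vᴴ * diagConj U p * U) =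
          Vᴴ * diagConj U p * U := by
        ext j i
        rw [diagonal_mul]
        by_cases hq : q j = 0
        · rw [key, overlap_mul_eq_zero_iff.1 (h (j, i) hq), mul_zero]
        · rw [mul_inv_cancel₀ hq]
          simp
      rw [e1, e2]
      have : V * (Vᴴ * diagConj U p * U) * Uᴴ = (V * Vᴴ) * diagConj U p * (U * Uᴴ) := by
        simp only [Matrix.mul_assoc]
      rw [this, mul_conjTranspose_self_of_mem hU, mul_conjTranspose_self_of_mem hV,
        Matrix.one_mul, Matrix.mul_one]
    refine ⟨(diagConj V (fun j => (q j)⁻¹) * diagConj U p) *ᵥ x, ?_⟩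
    rw [mulVecLin_apply, mulVecLin_apply, mulVec_mulVec, ← hfac]

theorem log₂_eq {ρ : QState n} {U : Matrix n n ℂ} (hU : U ∈ unitaryGroup n ℂ) {p : n → ℝ}
    (h : ρ.mat = diagConj U p) : log₂ ρ = diagConj U (fun i => Real.logb 2 (p i)) :=
  cfc_eq_diagConj _ hU h _

theorem relEntropy_trace {ρ σ : QState n} {U V : Matrix n n ℂ} (hU : U ∈ unitaryGroup n ℂ)
    (hV : V ∈ unitaryGroup n ℂ) {p q : n → ℝ} (hρ : ρ.mat = diagConj U p)
    (hσ : σ.mat = diagConj V q) :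
    ((ρ.mat * log₂ ρ).trace - (ρ.mat * log₂ σ).trace).re =
      divSum (overlap V U) (fun x => p x.2) (fun x => q x.1) / Real.log 2 := by
  rw [log₂_eq hU hρ, log₂_eq hV hσ, hρ, Complex.sub_re, trace_diagConj_mul U V, diagConj_mul hU,
    trace_diagConj hU, Complex.ofReal_re, divSum_overlap hU hV, sub_div, Finset.sum_div,
    Finset.sum_div]
  simp only [Real.logb, mul_div_assoc]

theorem relEntropy_of_support {ρ σ : QState n} {U V : Matrix n n ℂ} (hU : U ∈ unitaryGroup n ℂ)
    (hV : V ∈ unitaryGroup n ℂ) {p q : n → ℝ} (hρ : ρ.mat = diagConj U p)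
    (hσ : σ.mat = diagConj V q) (hs : ∀ x : n × n, q x.1 = 0 → overlap V U x * p x.2 = 0) :
    relEntropy ρ σ =
      ((divSum (overlap V U) (fun x => p x.2) (fun x => q x.1) / Real.log 2 : ℝ) : EReal) := by
  rw [relEntropy, if_pos, relEntropy_trace hU hV hρ hσ]
  rw [hρ, hσ]
  exact (supp_le_supp_iff hU hV p q).2 hs

theorem relEntropy_of_not_support {ρ σ : QState n} {U V : Matrix n n ℂ}
    (hU : U ∈ unitaryGroup n ℂ) (hV : V ∈ unitaryGroup n ℂ) {p q : n → ℝ}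
    (hρ : ρ.mat = diagConj U p) (hσ : σ.mat = diagConj V q)
    (hs : ¬ ∀ x : n × n, q x.1 = 0 → overlap V U x * p x.2 = 0) : relEntropy ρ σ = ⊤ := by
  rw [relEntropy, if_neg]
  rw [hρ, hσ]
  exact fun h => hs ((supp_le_supp_iff hU hV p q).1 h)

end Diag

/-! ## Monotonicity of the relative entropy under quantum operations -/

section DataProcessing

open Matrix

variable {m n : Type} [Fintype m] [Fintype n] [DecidableEq m] [DecidableEq n]

/-- The adjoint of a linear map between matrix algebras for the pairing `(X, Y) ↦ tr (X Y)`. -/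
def traceAdjoint (Φ : Matrix m m ℂ →ₗ[ℂ] Matrix n n ℂ) (Y : Matrix n n ℂ) : Matrix m m ℂ :=
  of fun i j => (Y * Φ (single j i 1)).trace

theorem trace_traceAdjoint_mul (Φ : Matrix m m ℂ →ₗ[ℂ] Matrix n n ℂ) (Y : Matrix n n ℂ)
    (Z : Matrix m m ℂ) : (traceAdjoint Φ Y * Z).trace = (Y * Φ Z).trace := by
  have hZ : Φ Z = ∑ i, ∑ j, Z i j • Φ (single i j 1) := by
    conv_lhs => rw [matrix_eq_sum_single Z]
    simp only [map_sum, ← LinearMap.map_smul, smul_single, smul_eq_mul, mul_one]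
  rw [hZ]
  simp only [Finset.mul_sum, trace_sum, mul_smul_comm, trace_smul, smul_eq_mul]
  rw [Finset.sum_comm, trace]
  refine Finset.sum_congr rfl fun i _ => ?_
  rw [diag_apply, mul_apply]
  exact Finset.sum_congr rfl fun j _ => mul_comm _ _

/-- The block matrix with blocks `Bₐᴴ σ B_b`. -/
def blockMatrix {l : Type} (σ : Matrix m m ℂ) (B : Fin 2 → Matrix m l ℂ) :
    Matrix (l × Fin 2) (l × Fin 2) ℂ :=
  (of fun i x => B x.2 i x.1 : Matrix m (l × Fin 2) ℂ)ᴴ * σ * of fun i x => B x.2 i x.1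

theorem blockMatrix_posSemidef {l : Type} [Fintype l] {σ : Matrix m m ℂ} (hσ : σ.PosSemidef)
    (B : Fin 2 → Matrix m l ℂ) : (blockMatrix σ B).PosSemidef :=
  hσ.conjTranspose_mul_mul_same _

theorem ampliation_blockMatrix (Φ : Matrix m m ℂ →ₗ[ℂ] Matrix n n ℂ) (σ : Matrix m m ℂ)
    (B : Fin 2 → Matrix m m ℂ) (x y : n × Fin 2) :
    ampliation Φ 2 (blockMatrix σ B) x y = Φ ((B x.2)ᴴ * σ * B y.2) x.1 y.1 := rfl

variable {Φ : Matrix m m ℂ →ₗ[ℂ] Matrix n n ℂ}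

/-- The positive block matrix with rows `(1, Z)` and `(Zᴴ, Zᴴ Z)` has a Hermitian image under `Φ ⊗
id`; compare its off-diagonal blocks. -/
theorem IsQuantumOperation.map_conjTranspose (hΦ : IsQuantumOperation Φ) (Z : Matrix m m ℂ) :
    Φ Zᴴ = (Φ Z)ᴴ := by
  have h := (hΦ.completelyPositive 2 _ (blockMatrix_posSemidef PosSemidef.one ![1, Z])).1
  ext x y
  have h2 := congrFun (congrFun h (x, 1)) (y, 0)
  rw [conjTranspose_apply, ampliation_blockMatrix, ampliation_blockMatrix] at h2
  simpa using h2.symm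

theorem IsQuantumOperation.traceAdjoint_conjTranspose (hΦ : IsQuantumOperation Φ)
    (Y : Matrix n n ℂ) : traceAdjoint Φ Yᴴ = (traceAdjoint Φ Y)ᴴ := by
  ext i j
  rw [conjTranspose_apply]
  simp only [traceAdjoint, of_apply]
  rw [← trace_conjTranspose, conjTranspose_mul, ← hΦ.map_conjTranspose, conjTranspose_single,
    star_one, trace_mul_comm]

/-- This is the trace of `Cᴴ N C`, where `C` is the block column with blocks `C 0` and `C 1`. -/
theorem trace_block_nonneg {N : Matrix (n × Fin 2) (n × Fin 2) ℂ} (hN : N.PosSemidef)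
    (C : Fin 2 → Matrix n n ℂ) :
    0 ≤ (∑ a, ∑ b, ((C a)ᴴ * (of fun x y => N (x, a) (y, b)) * C b).trace).re := by
  have h := (hN.conjTranspose_mul_mul_same (of fun x j => C x.2 x.1 j)).trace_nonneg
  convert (Complex.le_def.1 h).1 using 2
  · rfl
  simp only [trace, diag_apply, mul_apply, conjTranspose_apply, of_apply,
    Fintype.sum_prod_type_right, Fin.sum_univ_two, add_mul, Finset.sum_add_distrib]
  ring

/-- A Schwarz inequality from 2-positivity. Apply `Φ ⊗ id` to the block matrix of `σ` built from
`(1, X)`, where `X` is the adjoint image of `Y`, and test the result with `(Y, -1)`. The two cross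
terms and, by trace preservation, the last block all have the value `tr (Xᴴ σ X)`, the cross terms
with a minus sign. -/
theorem IsQuantumOperation.trace_le (hΦ : IsQuantumOperation Φ) {σ : Matrix m m ℂ}
    (hσ : σ.PosSemidef) (Y : Matrix n n ℂ) :
    ((traceAdjoint Φ Y)ᴴ * σ * traceAdjoint Φ Y).trace.re ≤ (Yᴴ * Φ σ * Y).trace.re := by
  set X := traceAdjoint Φ Y with hX
  have h := trace_block_nonneg
    (hΦ.completelyPositive 2 _ (blockMatrix_posSemidef hσ ![1, X])) ![Y, -1]
  have hb : ∀ a b, (of fun x y => ampliation Φ 2 (blockMatrix σ ![1, X]) (x, a) (y, b)) =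
      Φ ((![1, X] a)ᴴ * σ * ![1, X] b) := fun a b => rfl
  simp only [hb, Fin.sum_univ_two, Matrix.cons_val_zero, Matrix.cons_val_one,
    conjTranspose_one, Matrix.one_mul, Matrix.mul_one, conjTranspose_neg, Matrix.neg_mul,
    Matrix.mul_neg, neg_neg, trace_neg, hΦ.tracePreserving] at h
  have h1 : (Yᴴ * Φ (σ * X)).trace = (Xᴴ * σ * X).trace := by
    rw [← trace_traceAdjoint_mul, hΦ.traceAdjoint_conjTranspose, Matrix.mul_assoc]
  have h2 : (Φ (Xᴴ * σ) * Y).trace = (Xᴴ * σ * X).trace := by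
    rw [trace_mul_comm, ← trace_traceAdjoint_mul, trace_mul_comm]
  rw [h1, h2] at h
  simp only [Complex.add_re, Complex.neg_re] at h
  linarith

/-- Duality preserves the linear term; the two quadratic terms are controlled by the Schwarz
inequality for `Y` and for `Yᴴ`. -/
theorem IsQuantumOperation.quasiForm_le (hΦ : IsQuantumOperation Φ) {ρ σ : Matrix m m ℂ}
    (hρ : ρ.PosSemidef) (hσ : σ.PosSemidef) {t : ℝ} (ht : 0 < t) (Y : Matrix n n ℂ) :
    quasiForm t (Φ ρ) (Φ σ) Y ≤ quasiForm t ρ σ (traceAdjoint Φ Y) := by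
  have h1 := hΦ.trace_le hσ Y
  have h2 := hΦ.trace_le hρ Yᴴ
  rw [hΦ.traceAdjoint_conjTranspose, conjTranspose_conjTranspose, conjTranspose_conjTranspose]
    at h2
  have h3 : (Yᴴ * Φ ρ).trace = ((traceAdjoint Φ Y)ᴴ * ρ).trace := by
    rw [← trace_traceAdjoint_mul, hΦ.traceAdjoint_conjTranspose]
  rw [quasiForm, quasiForm, h3]
  have := mul_le_mul_of_nonneg_left h2 ht.le
  linarith

theorem IsQuantumOperation.relEntropy_le (hΦ : IsQuantumOperation Φ) {ρ σ : QState m}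
    {ρ' σ' : QState n} (hρ : Φ ρ.mat = ρ'.mat) (hσ : Φ σ.mat = σ'.mat) :
    relEntropy ρ' σ' ≤ relEntropy ρ σ := by
  obtain ⟨U, hU, p, hp, hUp⟩ := PosSemidef.exists_diagConj ρ.posSemidef
  obtain ⟨V, hV, q, hq, hVq⟩ := PosSemidef.exists_diagConj σ.posSemidef
  obtain ⟨U', hU', p', hp', hUp'⟩ := PosSemidef.exists_diagConj ρ'.posSemidef
  obtain ⟨V', hV', q', hq', hVq'⟩ := PosSemidef.exists_diagConj σ'.posSemidef
  by_cases hs : ∀ x : m × m, q x.1 = 0 → overlap V U x * p x.2 = 0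
  swap
  · rw [relEntropy_of_not_support hU hV hUp hVq hs]
    exact le_top
  have hle : ∀ t, 0 < t → quasiSum (overlap V' U') (fun x => p' x.2) (fun x => q' x.1) t ≤
      quasiSum (overlap V U) (fun x => p x.2) (fun x => q x.1) t := by
    intro t ht
    -- The maximizer for the image pair, pulled back by the adjoint map, competes in the supremum
    -- for the original pair.
    obtain ⟨Y, hY⟩ := exists_quasiForm_eq hU' hV' hp' hq' ht
    rw [← hY, ← hUp', ← hVq', ← hρ, ← hσ]
    refine (hΦ.quasiForm_le ρ.posSemidef σ.posSemidef ht Y).trans ?_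
    rw [hUp, hVq]
    exact Discord.quasiForm_le hU hV hp hq ht _
  have hs' := support_of_quasiSum_le (overlap_nonneg V U) (fun x => hp x.2) (fun x => hq x.1)
    (overlap_nonneg V' U') (fun x => hp' x.2) (fun x => hq' x.1) hs hle
  have htr : ∑ i, p i = 1 := by
    have := ρ.trace_eq_one
    rw [hUp, trace_diagConj hU] at this
    exact_mod_cast this
  have htr' : ∑ i, p' i = 1 := by
    have := ρ'.trace_eq_one
    rw [hUp', trace_diagConj hU'] at this
    exact_mod_cast this
  rw [relEntropy_of_support hU hV hUp hVq hs, relEntropy_of_support hU' hV' hUp' hVq' hs',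
    EReal.coe_le_coe_iff]
  refine div_le_div_of_nonneg_right (divSum_le_of_quasiSum_le (fun x => hp x.2) (fun x => hq x.1)
    (fun x => hp' x.2) (fun x => hq' x.1) hs hs' ?_ hle) (Real.log_nonneg one_le_two)
  rw [sum_overlap_mul_left hU hV, sum_overlap_mul_left hU' hV', htr, htr']

end DataProcessing

/-! ## Entropies and the entropy gap of a basis -/

section Gap

open Matrix

variable {n : Type} [Fintype n] [DecidableEq n]

theorem diagConj_isHermitian (U : Matrix n n ℂ) (p : n → ℝ) : (diagConj U p).IsHermitian := by
  rw [IsHermitian, diagConj, conjTranspose_mul, conjTranspose_mul, conjTranspose_conjTranspose,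
    diagonal_conjTranspose, Matrix.mul_assoc]
  congr 3
  ext i
  simp

theorem diagConj_posSemidef (U : Matrix n n ℂ) {p : n → ℝ} (hp : ∀ i, 0 ≤ p i) :
    (diagConj U p).PosSemidef :=
  (PosSemidef.diagonal fun i => by
    rw [Pi.zero_apply]; exact Complex.zero_le_real.2 (hp i)).mul_mul_conjTranspose_same U

open Classical in
/-- The sum of the values of `f` at the eigenvalues of a Hermitian matrix. -/
def eigSum (f : ℝ → ℝ) (M : Matrix n n ℂ) : ℝ :=
  if h : M.IsHermitian then ∑ i, f (h.eigenvalues i) else 0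

/-- Take traces in `diagConj_comp`; the eigenvalues need not be matched one by one. -/
theorem eigSum_diagConj (f : ℝ → ℝ) {U : Matrix n n ℂ} (hU : U ∈ unitaryGroup n ℂ) (p : n → ℝ) :
    eigSum f (diagConj U p) = ∑ i, f (p i) := by
  have hM := diagConj_isHermitian U p
  have h := congrArg trace (diagConj_comp hU hM.eigenvectorUnitary.2 (diagConj_eigen hM).symm f)
  rw [trace_diagConj hM.eigenvectorUnitary.2, trace_diagConj hU] at h
  rw [eigSum, dif_pos hM]
  exact_mod_cast h

/-- The von Neumann entropy (with the natural logarithm). -/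
def entropy (M : Matrix n n ℂ) : ℝ := eigSum Real.negMulLog M

/-- The diagonal of an operator in the basis of the columns of `W`. -/
def basisDiag (W M : Matrix n n ℂ) (k : n) : ℝ := ((Wᴴ * M * W) k k).re

/-- The entropy of the diagonal of an operator in the basis of the columns of `W`. -/
def basisEntropy (W M : Matrix n n ℂ) : ℝ := ∑ k, Real.negMulLog (basisDiag W M k)

/-- The increase of entropy in the complete dephasing in the basis of the columns of `W`. -/
def entropyGap (W M : Matrix n n ℂ) : ℝ := basisEntropy W M - entropy M

theorem basisDiag_add (W M N : Matrix n n ℂ) (k : n) :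
    basisDiag W (M + N) k = basisDiag W M k + basisDiag W N k := by
  simp [basisDiag, Matrix.mul_add, Matrix.add_mul]

theorem basisDiag_nonneg (W : Matrix n n ℂ) {M : Matrix n n ℂ} (hM : M.PosSemidef) (k : n) :
    0 ≤ basisDiag W M k :=
  (Complex.le_def.1 (hM.conjTranspose_mul_mul_same W).diag_nonneg).1

theorem sum_basisDiag {W : Matrix n n ℂ} (hW : W ∈ unitaryGroup n ℂ) (M : Matrix n n ℂ) :
    ∑ k, basisDiag W M k = M.trace.re := by
  have : M.trace = (Wᴴ * M * W).trace := by
    rw [trace_mul_comm, ← Matrix.mul_assoc, mul_conjTranspose_self_of_mem hW, Matrix.one_mul]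
  rw [this, trace, Complex.re_sum]
  rfl

theorem basisDiag_diagConj (W U : Matrix n n ℂ) (p : n → ℝ) (j : n) :
    basisDiag W (diagConj U p) j = ∑ i, overlap W U (j, i) * p i := by
  have : Wᴴ * diagConj U p * W = (Wᴴ * U) * diagonal (fun i => (p i : ℂ)) * (Wᴴ * U)ᴴ := by
    rw [conjTranspose_mul, conjTranspose_conjTranspose]
    simp only [diagConj, Matrix.mul_assoc]
  rw [basisDiag, this, mul_apply, Complex.re_sum]
  refine Finset.sum_congr rfl fun i _ => ?_
  rw [mul_diagonal, conjTranspose_apply, overlap, Complex.normSq_apply]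
  simp
  ring

theorem basisDiag_diagConj_self {W : Matrix n n ℂ} (hW : W ∈ unitaryGroup n ℂ) (p : n → ℝ) :
    basisDiag W (diagConj W p) = p := by
  ext j
  have : Wᴴ * diagConj W p * W = (Wᴴ * W) * diagonal (fun i => (p i : ℂ)) * (Wᴴ * W) := by
    simp only [diagConj, Matrix.mul_assoc]
  rw [basisDiag, this, conjTranspose_mul_self_of_mem hW, Matrix.one_mul, Matrix.mul_one,
    diagonal_apply_eq, Complex.ofReal_re]

theorem support_basisDiag {W U : Matrix n n ℂ} {p : n → ℝ} (hp : ∀ i, 0 ≤ p i) (x : n × n)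
    (hx : basisDiag W (diagConj U p) x.1 = 0) : overlap W U x * p x.2 = 0 := by
  rw [basisDiag_diagConj] at hx
  exact (Finset.sum_eq_zero_iff_of_nonneg fun i _ =>
    mul_nonneg (overlap_nonneg W U _) (hp i)).1 hx x.2 (Finset.mem_univ _)

/-- Against an operator diagonal in `W`, the first argument enters only through its entropy and its
diagonal in `W`. -/
theorem divSum_eq_basis {W U : Matrix n n ℂ} (hU : U ∈ unitaryGroup n ℂ)
    (hW : W ∈ unitaryGroup n ℂ) (p q : n → ℝ) :
    divSum (overlap W U) (fun x => p x.2) (fun x => q x.1) =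
      -entropy (diagConj U p) - ∑ j, basisDiag W (diagConj U p) j * Real.log (q j) := by
  rw [divSum_overlap hU hW, entropy, eigSum_diagConj _ hU, ← Finset.sum_neg_distrib]
  congr 1
  · exact Finset.sum_congr rfl fun i _ => by simp [Real.negMulLog]
  · rw [Fintype.sum_prod_type]
    refine Finset.sum_congr rfl fun j _ => ?_
    rw [basisDiag_diagConj, Finset.sum_mul]

/-- The gap is a divergence from the dephased operator, which makes the comparison of
quasi-entropies available for it. -/
theorem entropyGap_eq_divSum {W U : Matrix n n ℂ} (hU : U ∈ unitaryGroup n ℂ)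
    (hW : W ∈ unitaryGroup n ℂ) (p : n → ℝ) :
    entropyGap W (diagConj U p) = divSum (overlap W U) (fun x => p x.2)
      (fun x => basisDiag W (diagConj U p) x.1) := by
  rw [divSum_eq_basis hU hW, entropyGap, basisEntropy]
  simp only [Real.negMulLog, neg_mul, Finset.sum_neg_distrib]
  ring

/-- The excess of the right-hand side is the classical divergence between the diagonal of the
operator in `W` and `q`, which is nonnegative because the total masses agree. -/
theorem entropyGap_le_divSum {W U : Matrix n n ℂ} (hU : U ∈ unitaryGroup n ℂ)
    (hW : W ∈ unitaryGroup n ℂ) {p q : n → ℝ} (hp : ∀ i, 0 ≤ p i) (hq : ∀ i, 0 ≤ q i)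
    (hs : ∀ x : n × n, q x.1 = 0 → overlap W U x * p x.2 = 0) (hsum : ∑ i, q i = ∑ i, p i) :
    entropyGap W (diagConj U p) ≤
      divSum (overlap W U) (fun x => p x.2) (fun x => q x.1) := by
  set r := basisDiag W (diagConj U p) with hr
  have hr0 : ∀ j, 0 ≤ r j := basisDiag_nonneg W (diagConj_posSemidef U hp)
  have h := divSum_ge (m := fun _ : n => (1 : ℝ)) (p := r) (q := q) (fun _ => zero_le_one) hr0 hq
    (fun j hj => by
      rw [one_mul, hr, basisDiag_diagConj]
      exact Finset.sum_eq_zero fun i _ => hs (j, i) hj)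
  have hrs : ∑ j, r j = ∑ i, p i := by
    rw [hr, sum_basisDiag hW, trace_diagConj hU, Complex.ofReal_re]
  simp only [one_mul, Finset.sum_sub_distrib, hrs, hsum, sub_self, divSum, mul_sub] at h
  rw [divSum_eq_basis hU hW, entropyGap, basisEntropy]
  simp only [Real.negMulLog, neg_mul, Finset.sum_neg_distrib]
  linarith

theorem entropyGap_nonneg {W M : Matrix n n ℂ} (hW : W ∈ unitaryGroup n ℂ) (hM : M.PosSemidef) :
    0 ≤ entropyGap W M := by
  obtain ⟨U, hU, p, hp, rfl⟩ := PosSemidef.exists_diagConj hM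
  rw [entropyGap_eq_divSum hU hW]
  refine le_trans (le_of_eq ?_) (divSum_ge (overlap_nonneg W U) (fun x => hp x.2)
    (fun x => basisDiag_nonneg W hM x.1) fun x hx => support_basisDiag hp x hx)
  simp only [mul_sub, Finset.sum_sub_distrib]
  rw [sum_overlap_mul_left hU hW, sum_overlap_mul_right hU hW, sum_basisDiag hW,
    trace_diagConj hU, Complex.ofReal_re, sub_self]

/-- Nonnegativity of the divergence from the uniform distribution of the same total mass. -/
theorem sum_negMulLog_le {ι : Type*} [Fintype ι] {q : ι → ℝ} (hq : ∀ i, 0 ≤ q i) :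
    ∑ i, Real.negMulLog (q i) ≤
      (∑ i, q i) * Real.log (Fintype.card ι) + Real.negMulLog (∑ i, q i) := by
  rcases (Finset.sum_nonneg fun i (_ : i ∈ Finset.univ) => hq i).eq_or_lt with h | h
  · have : ∀ i, q i = 0 := fun i =>
      (Finset.sum_eq_zero_iff_of_nonneg fun i _ => hq i).1 h.symm i (Finset.mem_univ _)
    simp [this]
  · have hne : Nonempty ι := by
      by_contra hc
      rw [not_nonempty_iff] at hc
      simp at h
    set s := ∑ i, q i with hs
    have hD : (0 : ℝ) < Fintype.card ι := by exact_mod_cast Fintype.card_pos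
    have h1 := divSum_ge (m := fun _ : ι => (1 : ℝ)) (p := q)
      (q := fun _ => s / Fintype.card ι) (fun _ => zero_le_one) hq
      (fun _ => by positivity) (fun i hi => absurd hi (by positivity))
    simp only [divSum, one_mul, Finset.sum_sub_distrib, mul_sub, ← Finset.sum_mul, ← hs,
      Finset.sum_const, Finset.card_univ, nsmul_eq_mul] at h1
    rw [mul_div_cancel₀ _ hD.ne', sub_self, Real.log_div h.ne' hD.ne'] at h1
    simp only [Real.negMulLog, neg_mul, Finset.sum_neg_distrib]
    linarith

theorem entropyGap_le {W M : Matrix n n ℂ} (hW : W ∈ unitaryGroup n ℂ) (hM : M.PosSemidef) :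
    entropyGap W M ≤ M.trace.re * Real.log (Fintype.card n) := by
  obtain ⟨U, hU, p, hp, rfl⟩ := PosSemidef.exists_diagConj hM
  have h1 := sum_negMulLog_le (basisDiag_nonneg W hM)
  rw [sum_basisDiag hW, trace_diagConj hU, Complex.ofReal_re] at h1
  rw [trace_diagConj hU, Complex.ofReal_re, entropyGap, basisEntropy, entropy,
    eigSum_diagConj _ hU]
  -- Each eigenvalue is at most the trace, so replacing `log (p i)` by the logarithm of the trace
  -- lowers the entropy. This cancels the `negMulLog` term of `h1`.
  have h2 : Real.negMulLog (∑ i, p i) ≤ ∑ i, Real.negMulLog (p i) := by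
    rw [Real.negMulLog, ← Finset.sum_neg_distrib, Finset.sum_mul]
    refine Finset.sum_le_sum fun i _ => ?_
    rw [Real.negMulLog]
    rcases (hp i).eq_or_lt with h | h
    · simp [← h]
    · have := Real.log_le_log h (Finset.single_le_sum (fun i _ => hp i) (Finset.mem_univ i))
      nlinarith
  linarith

theorem quasiForm_add (t : ℝ) (ρ₁ ρ₂ σ₁ σ₂ X : Matrix n n ℂ) :
    quasiForm t (ρ₁ + ρ₂) (σ₁ + σ₂) X = quasiForm t ρ₁ σ₁ X + quasiForm t ρ₂ σ₂ X := by
  simp only [quasiForm, Matrix.mul_add, Matrix.add_mul, trace_add, Complex.add_re]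
  ring

theorem diagConj_add (U : Matrix n n ℂ) (p q : n → ℝ) :
    diagConj U (p + q) = diagConj U p + diagConj U q := by
  have : diagonal (fun i => ((p + q) i : ℂ)) =
      diagonal (fun i => (p i : ℂ)) + diagonal (fun i => (q i : ℂ)) := by
    rw [diagonal_add]
    simp
  rw [diagConj, diagConj, diagConj, this, Matrix.mul_add, Matrix.add_mul]

theorem divSum_sum_elim {K L : Type*} [Fintype K] [Fintype L] (m p q : K → ℝ) (m' p' q' : L → ℝ) :
    divSum (Sum.elim m m') (Sum.elim p p') (Sum.elim q q') = divSum m p q + divSum m' p' q' := by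
  simp [divSum]

theorem quasiSum_sum_elim {K L : Type*} [Fintype K] [Fintype L] (m p q : K → ℝ)
    (m' p' q' : L → ℝ) (t : ℝ) :
    quasiSum (Sum.elim m m') (Sum.elim p p') (Sum.elim q q') t =
      quasiSum m p q t + quasiSum m' p' q' t := by
  simp [quasiSum]

/-- Convexity of the entropy gap, in its homogeneous form. -/
theorem entropyGap_add_le {W M N : Matrix n n ℂ} (hW : W ∈ unitaryGroup n ℂ) (hM : M.PosSemidef)
    (hN : N.PosSemidef) : entropyGap W (M + N) ≤ entropyGap W M + entropyGap W N := by
  obtain ⟨U, hU, p, hp, hMU⟩ := PosSemidef.exists_diagConj hM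
  obtain ⟨U', hU', p', hp', hNU⟩ := PosSemidef.exists_diagConj hN
  obtain ⟨V, hV, r, hr, hMN⟩ := PosSemidef.exists_diagConj (hM.add hN)
  have hq := basisDiag_nonneg W hM
  have hq' := basisDiag_nonneg W hN
  have hqr := basisDiag_nonneg W (hM.add hN)
  have e1 := entropyGap_eq_divSum hU hW p
  have e2 := entropyGap_eq_divSum hU' hW p'
  have e3 := entropyGap_eq_divSum hV hW r
  rw [← hMU] at e1
  rw [← hNU] at e2
  rw [← hMN] at e3
  -- The sum of the two gaps becomes one divergence over a disjoint union of index sets, to be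
  -- compared with the divergence of `M + N`.
  rw [e1, e2, e3, ← divSum_sum_elim]
  refine divSum_le_of_quasiSum_le ?_ ?_ (fun x => hr x.2) (fun x => hqr x.1) ?_ ?_ ?_ ?_
  · rintro (x | x)
    exacts [hp x.2, hp' x.2]
  · rintro (x | x)
    exacts [hq x.1, hq' x.1]
  · rintro (x | x) hx
    · rw [hMU] at hx
      exact support_basisDiag hp x hx
    · rw [hNU] at hx
      exact support_basisDiag hp' x hx
  · intro x hx
    rw [hMN] at hx
    exact support_basisDiag hr x hx
  · rw [Fintype.sum_sum_type]
    simp only [Sum.elim_inl, Sum.elim_inr]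
    rw [sum_overlap_mul_left hU hW, sum_overlap_mul_left hU' hW, sum_overlap_mul_left hV hW]
    have := congrArg trace hMN
    rw [trace_add, hMU, hNU, trace_diagConj hU, trace_diagConj hU', trace_diagConj hV] at this
    exact_mod_cast this.symm
  · intro t ht
    rw [quasiSum_sum_elim]
    -- The maximizer for `M + N` is a competitor for `M` and for `N`. As dephasing is additive and
    -- the form is linear in the pair, the two values add up.
    obtain ⟨X, hX⟩ := exists_quasiForm_eq hV hW hr hqr ht
    have hsum : diagConj W (basisDiag W (M + N)) =
        diagConj W (basisDiag W M) + diagConj W (basisDiag W N) := by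
      rw [← diagConj_add]
      congr 1
      ext k
      exact basisDiag_add W M N k
    rw [← hX, ← hMN, hsum, quasiForm_add]
    refine add_le_add ?_ ?_
    · rw [hMU]
      exact quasiForm_le hU hW hp (fun k => basisDiag_nonneg W (diagConj_posSemidef U hp) k) ht X
    · rw [hNU]
      exact quasiForm_le hU' hW hp' (fun k => basisDiag_nonneg W (diagConj_posSemidef U' hp') k)
        ht X

/-- Operator monotonicity of the logarithm, as far as it concerns the entropy. -/
theorem divSum_add_nonpos {U V : Matrix n n ℂ} (hU : U ∈ unitaryGroup n ℂ)
    (hV : V ∈ unitaryGroup n ℂ) {p r : n → ℝ} (hp : ∀ i, 0 ≤ p i) (hr : ∀ i, 0 ≤ r i)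
    (h : (diagConj V r - diagConj U p).PosSemidef) :
    divSum (overlap V U) (fun x => p x.2) (fun x => r x.1) ≤ 0 := by
  -- The comparison is with the divergence of `diagConj U p` from itself, which is zero.
  have e0 : divSum (fun _ : n => (1 : ℝ)) p p = 0 := by simp [divSum]
  have hle : ∀ t, 0 < t → quasiSum (overlap V U) (fun x => p x.2) (fun x => r x.1) t ≤
      quasiSum (fun _ : n => (1 : ℝ)) p p t := by
    intro t ht
    obtain ⟨X, hX⟩ := exists_quasiForm_eq hU hV hp hr ht
    rw [← hX]
    -- The form decreases when its second argument grows.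
    have h1 : quasiForm t (diagConj U p) (diagConj V r) X ≤
        quasiForm t (diagConj U p) (diagConj U p) X := by
      have := (Complex.le_def.1 (h.conjTranspose_mul_mul_same X).trace_nonneg).1
      rw [Matrix.mul_sub, Matrix.sub_mul, trace_sub, Complex.sub_re, Complex.zero_re] at this
      simp only [quasiForm]
      linarith
    refine (h1.trans (quasiForm_le hU hU hp hp ht X)).trans (le_of_eq ?_)
    rw [quasiSum, quasiSum, Fintype.sum_prod_type]
    refine Finset.sum_congr rfl fun j _ => ?_
    rw [Finset.sum_eq_single j (fun i _ hi => by
      simp [overlap, conjTranspose_mul_self_of_mem hU, one_apply_ne (Ne.symm hi)]) (by simp)]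
    simp [overlap, conjTranspose_mul_self_of_mem hU]
  have hs : ∀ k, p k = 0 → (1 : ℝ) * p k = 0 := fun k hk => by rw [hk, mul_zero]
  rw [← e0]
  refine divSum_le_of_quasiSum_le hp hp (fun x => hp x.2) (fun x => hr x.1) hs ?_ ?_ hle
  · exact support_of_quasiSum_le (fun _ => zero_le_one) hp hp (overlap_nonneg V U)
      (fun x => hp x.2) (fun x => hr x.1) hs hle
  · rw [sum_overlap_mul_left hU hV]
    simp

/-- Subadditivity of the entropy of unnormalized states. -/
theorem entropy_add_le {M N : Matrix n n ℂ} (hM : M.PosSemidef) (hN : N.PosSemidef) :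
    entropy (M + N) ≤ entropy M + entropy N := by
  obtain ⟨U, hU, p, hp, hMU⟩ := PosSemidef.exists_diagConj hM
  obtain ⟨U', hU', p', hp', hNU⟩ := PosSemidef.exists_diagConj hN
  obtain ⟨V, hV, r, hr, hMN⟩ := PosSemidef.exists_diagConj (hM.add hN)
  -- As `M ≤ M + N`, the entropy of `M` is at least `-tr (M log (M + N))`. The same holds for `N`,
  -- and these two lower bounds add up to the entropy of `M + N`.
  have h1 := divSum_add_nonpos hU hV hp hr (by rw [← hMU, ← hMN]; simpa using hN)
  have h2 := divSum_add_nonpos hU' hV hp' hr (by rw [← hNU, ← hMN]; simpa using hM)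
  rw [divSum_eq_basis hU hV, ← hMU] at h1
  rw [divSum_eq_basis hU' hV, ← hNU] at h2
  have h3 : entropy (M + N) = -∑ j, (basisDiag V M j + basisDiag V N j) * Real.log (r j) := by
    simp only [← basisDiag_add]
    rw [hMN, basisDiag_diagConj_self hV, entropy, eigSum_diagConj _ hV, ← Finset.sum_neg_distrib]
    exact Finset.sum_congr rfl fun j _ => by simp [Real.negMulLog]
  simp only [add_mul, Finset.sum_add_distrib] at h3
  linarith

/-- The log-sum inequality for two families. -/
theorem sum_negMulLog_add_ge {ι : Type*} [Fintype ι] {p q : ι → ℝ} (hp : ∀ i, 0 ≤ p i)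
    (hq : ∀ i, 0 ≤ q i) :
    ∑ i, Real.negMulLog (p i) - Real.negMulLog (∑ i, p i) +
      (∑ i, Real.negMulLog (q i) - Real.negMulLog (∑ i, q i)) ≤
    ∑ i, Real.negMulLog (p i + q i) - Real.negMulLog (∑ i, p i + ∑ i, q i) := by
  have key : ∀ p q : ι → ℝ, (∀ i, 0 ≤ p i) → (∀ i, 0 ≤ q i) →
      ∑ i, Real.negMulLog (p i) - Real.negMulLog (∑ i, p i) ≤
      -∑ i, p i * Real.log (p i + q i) + (∑ i, p i) * Real.log (∑ i, p i + ∑ i, q i) := by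
    intro p q hp hq
    rcases (Finset.sum_nonneg fun i (_ : i ∈ Finset.univ) => hp i).eq_or_lt with h | h
    · have : ∀ i, p i = 0 := fun i =>
        (Finset.sum_eq_zero_iff_of_nonneg fun i _ => hp i).1 h.symm i (Finset.mem_univ _)
      simp [this]
    · have hq0 : 0 ≤ ∑ i, q i := Finset.sum_nonneg fun i _ => hq i
      set a := ∑ i, p i with ha
      set b := ∑ i, q i with hb
      have hab : 0 < a + b := by linarith
      -- The comparison vector is `p + q` rescaled to the total mass `a` of `p`.
      have h1 := divSum_ge (m := fun _ : ι => (1 : ℝ)) (p := p)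
        (q := fun i => a / (a + b) * (p i + q i)) (fun _ => zero_le_one) hp
        (fun i => mul_nonneg (by positivity) (add_nonneg (hp i) (hq i)))
        (fun i hi => by
          have := (mul_eq_zero.1 hi).resolve_left (by positivity)
          have := hp i
          have := hq i
          rw [one_mul]
          linarith)
      have h2 : ∀ i, p i * Real.log (a / (a + b) * (p i + q i)) =
          p i * (Real.log a - Real.log (a + b)) + p i * Real.log (p i + q i) := by
        intro i
        rcases (hp i).eq_or_lt with h0 | h0
        · simp [← h0]
        · have : 0 < p i + q i := by have := hq i; linarith
          rw [Real.log_mul (by positivity) this.ne', Real.log_div h.ne' hab.ne']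
          ring
      simp only [divSum, one_mul, mul_sub, Finset.sum_sub_distrib] at h1
      simp only [h2, Finset.sum_add_distrib, ← Finset.mul_sum, ← Finset.sum_mul, ← ha, ← hb] at h1
      rw [div_mul_cancel₀ _ hab.ne', sub_self] at h1
      simp only [Real.negMulLog, neg_mul, Finset.sum_neg_distrib]
      linarith
  have h1 := key p q hp hq
  have h2 := key q p hq hp
  rw [add_comm (∑ i, q i) (∑ i, p i)] at h2
  simp only [add_comm (q _) (p _)] at h2
  have h3 : ∑ i, Real.negMulLog (p i + q i) =
      -∑ i, p i * Real.log (p i + q i) + -∑ i, q i * Real.log (p i + q i) := by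
    rw [← neg_add, ← Finset.sum_add_distrib, ← Finset.sum_neg_distrib]
    exact Finset.sum_congr rfl fun i _ => by rw [Real.negMulLog]; ring
  have h4 : Real.negMulLog (∑ i, p i + ∑ i, q i) =
      -((∑ i, p i) * Real.log (∑ i, p i + ∑ i, q i)) -
        (∑ i, q i) * Real.log (∑ i, p i + ∑ i, q i) := by
    rw [Real.negMulLog]; ring
  linarith

/-- Approximate concavity of the entropy gap. -/
theorem le_entropyGap_add {W M N : Matrix n n ℂ} (hW : W ∈ unitaryGroup n ℂ) (hM : M.PosSemidef)
    (hN : N.PosSemidef) :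
    entropyGap W M + entropyGap W N - Real.negMulLog M.trace.re - Real.negMulLog N.trace.re
      + Real.negMulLog (M.trace.re + N.trace.re) ≤ entropyGap W (M + N) := by
  -- The entropy enters the gap negatively, so its subadditivity helps directly; the `negMulLog`
  -- terms of the traces come only from the diagonals.
  have h1 := entropy_add_le hM hN
  have h2 := sum_negMulLog_add_ge (basisDiag_nonneg W hM) (basisDiag_nonneg W hN)
  rw [sum_basisDiag hW, sum_basisDiag hW] at h2
  simp only [entropyGap, basisEntropy, basisDiag_add]
  linarith

end Gap

/-! ## The relative entropy of discord as a minimum over local bases -/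

section LocalBases

open Matrix

variable {n : Type} [Fintype n] [DecidableEq n]

theorem diagConj_apply (U : Matrix n n ℂ) (p : n → ℝ) (x y : n) :
    diagConj U p x y = ∑ k, (p k : ℂ) * (U x k * star (U y k)) := by
  rw [diagConj, mul_apply]
  refine Finset.sum_congr rfl fun k _ => ?_
  rw [mul_diagonal, conjTranspose_apply]
  ring

theorem exists_unitary_of_orthonormalBasis (a : OrthonormalBasis n ℂ (EuclideanSpace ℂ n)) :
    ∃ U ∈ unitaryGroup n ℂ, ∀ x i, U x i = a i x :=
  ⟨(EuclideanSpace.basisFun n ℂ).toBasis.toMatrix a.toBasis,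
    (EuclideanSpace.basisFun n ℂ).toMatrix_orthonormalBasis_mem_unitary a, fun _ _ => rfl⟩

theorem exists_orthonormalBasis_of_unitary {U : Matrix n n ℂ} (hU : U ∈ unitaryGroup n ℂ) :
    ∃ a : OrthonormalBasis n ℂ (EuclideanSpace ℂ n), ∀ x i, a i x = U x i := by
  have hon : Orthonormal ℂ (fun i => WithLp.toLp 2 (U.col i) : n → EuclideanSpace ℂ n) := by
    rw [orthonormal_iff_ite]
    intro i j
    have h := congrFun (congrFun (conjTranspose_mul_self_of_mem hU) i) j
    rw [mul_apply, one_apply] at h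
    rw [← h, EuclideanSpace.inner_eq_star_dotProduct, dotProduct]
    exact Finset.sum_congr rfl fun k _ => mul_comm _ _
  obtain ⟨b, hb⟩ := Orthonormal.exists_orthonormalBasis_extension_of_card_eq
    (𝕜 := ℂ) (s := Set.univ) (v := fun i => WithLp.toLp 2 (U.col i))
    (by rw [finrank_euclideanSpace]) (hon.comp _ Subtype.val_injective)
  exact ⟨b, fun x i => by rw [hb i (Set.mem_univ i)]; rfl⟩

theorem sum_ketBra_eq_diagConj {m : Type} [Fintype m] [DecidableEq m]
    {a : n → EuclideanSpace ℂ n} {b : m → EuclideanSpace ℂ m} {U : Matrix n n ℂ}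
    {V : Matrix m m ℂ} (ha : ∀ x i, U x i = a i x) (hb : ∀ x i, V x i = b i x)
    (p : n × m → ℝ) :
    ∑ i, ∑ j, (p (i, j) : ℂ) • (ketBra (a i) ⊗ₖ ketBra (b j)) = diagConj (U ⊗ₖ V) p := by
  ext x y
  rw [diagConj_apply, Fintype.sum_prod_type, Matrix.sum_apply]
  refine Finset.sum_congr rfl fun i _ => ?_
  rw [Matrix.sum_apply]
  refine Finset.sum_congr rfl fun j _ => ?_
  simp only [Matrix.smul_apply, kroneckerMap_apply, ketBra, vecMulVec_apply, Pi.star_apply,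
    smul_eq_mul, ha, hb, star_mul']
  ring

/-- A unitary matrix that maps the product basis to a product of local orthonormal bases. -/
def IsLocalUnitary (S : BipartiteSystem) (W : Op S) : Prop :=
  ∃ U ∈ unitaryGroup S.A ℂ, ∃ V ∈ unitaryGroup S.B ℂ, W = U ⊗ₖ V

theorem IsLocalUnitary.mem {S : BipartiteSystem} {W : Op S} (h : IsLocalUnitary S W) :
    W ∈ unitaryGroup S.Idx ℂ := by
  obtain ⟨U, hU, V, hV, rfl⟩ := h
  exact kronecker_mem_unitary hU hV

/-- Orthonormal bases are the columns of unitaries, so these states are exactly those diagonal in a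
product basis. -/
theorem mem_CC_iff {S : BipartiteSystem} {σ : State S} :
    σ ∈ CC S ↔ ∃ W, IsLocalUnitary S W ∧ ∃ p : S.Idx → ℝ, (∀ k, 0 ≤ p k) ∧ ∑ k, p k = 1 ∧
      σ.mat = diagConj W p := by
  constructor
  · rintro ⟨a, b, p, hp, hsum, hσ⟩
    obtain ⟨U, hU, ha⟩ := exists_unitary_of_orthonormalBasis a
    obtain ⟨V, hV, hb⟩ := exists_unitary_of_orthonormalBasis b
    refine ⟨U ⊗ₖ V, ⟨U, hU, V, hV, rfl⟩, fun x => p x.1 x.2, fun k => hp _ _, ?_, ?_⟩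
    · rw [Fintype.sum_prod_type, hsum]
    · rw [hσ, ← sum_ketBra_eq_diagConj ha hb]
  · rintro ⟨_, ⟨U, hU, V, hV, rfl⟩, p, hp, hsum, hσ⟩
    obtain ⟨a, ha⟩ := exists_orthonormalBasis_of_unitary hU
    obtain ⟨b, hb⟩ := exists_orthonormalBasis_of_unitary hV
    refine ⟨a, b, fun i j => p (i, j), fun i j => hp _, ?_, ?_⟩
    · rw [← hsum, Fintype.sum_prod_type]
    · rw [hσ, ← sum_ketBra_eq_diagConj (fun x i => (ha x i).symm) (fun x i => (hb x i).symm)]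

theorem isCompact_unitaryGroup : IsCompact (unitaryGroup n ℂ : Set (Matrix n n ℂ)) := by
  have hK : IsCompact (Set.univ.pi fun _ : n => Set.univ.pi fun _ : n =>
      Metric.closedBall (0 : ℂ) 1) :=
    isCompact_univ_pi fun _ => isCompact_univ_pi fun _ => isCompact_closedBall 0 1
  refine IsCompact.of_isClosed_subset hK ?_ ?_
  · have : (unitaryGroup n ℂ : Set (Matrix n n ℂ)) = {A | A * star A = 1} := by
      ext A
      exact mem_unitaryGroup_iff
    rw [this]
    exact isClosed_eq (by fun_prop) continuous_const
  · intro A hA i _ j _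
    rw [mem_closedBall_zero_iff]
    exact entry_norm_bound_of_unitary hA i j

theorem continuous_entropyGap (M : Matrix n n ℂ) :
    Continuous fun W : Matrix n n ℂ => entropyGap W M := by
  unfold entropyGap basisEntropy basisDiag
  refine Continuous.sub (continuous_finsetSum _ fun k _ => ?_) continuous_const
  refine Real.continuous_negMulLog.comp (Complex.continuous_re.comp ?_)
  have : Continuous fun W : Matrix n n ℂ => Wᴴ * M * W := by fun_prop
  exact this.matrix_elem k k

/-- The gap is continuous in the basis, and pairs of local unitaries form a compact set. -/
theorem exists_isLocalUnitary_min {S : BipartiteSystem} (φ : Op S) :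
    ∃ W, IsLocalUnitary S W ∧ ∀ W', IsLocalUnitary S W' → entropyGap W φ ≤ entropyGap W' φ := by
  have hk : Continuous fun x : Matrix S.A S.A ℂ × Matrix S.B S.B ℂ => x.1 ⊗ₖ x.2 := by
    refine continuous_matrix fun i j => ?_
    simp only [kroneckerMap_apply]
    fun_prop
  have hne : ((unitaryGroup S.A ℂ : Set (Matrix S.A S.A ℂ)) ×ˢ
      (unitaryGroup S.B ℂ : Set (Matrix S.B S.B ℂ))).Nonempty :=
    Set.Nonempty.prod ⟨1, one_mem (unitaryGroup S.A ℂ)⟩ ⟨1, one_mem (unitaryGroup S.B ℂ)⟩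
  have hc : Continuous fun x : Matrix S.A S.A ℂ × Matrix S.B S.B ℂ =>
      entropyGap (x.1 ⊗ₖ x.2) φ := (continuous_entropyGap φ).comp hk
  obtain ⟨x, hx, hmin⟩ := (isCompact_unitaryGroup.prod isCompact_unitaryGroup).exists_isMinOn
    hne hc.continuousOn
  refine ⟨x.1 ⊗ₖ x.2, ⟨x.1, hx.1, x.2, hx.2, rfl⟩, fun W' hW' => ?_⟩
  obtain ⟨U, hU, V, hV, rfl⟩ := hW'
  exact isMinOn_iff.1 hmin (U, V) (Set.mk_mem_prod hU hV)

theorem QState.sum_eq_one {ρ : QState n} {U : Matrix n n ℂ} (hU : U ∈ unitaryGroup n ℂ)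
    {p : n → ℝ} (h : ρ.mat = diagConj U p) : ∑ i, p i = 1 := by
  have := ρ.trace_eq_one
  rw [h, trace_diagConj hU] at this
  exact_mod_cast this

theorem QState.trace_re (ρ : QState n) : ρ.mat.trace.re = 1 := by
  rw [ρ.trace_eq_one, Complex.one_re]

theorem entropyGap_le_relEntropy {φ σ : QState n} {W : Matrix n n ℂ}
    (hW : W ∈ unitaryGroup n ℂ) {q : n → ℝ} (hq : ∀ k, 0 ≤ q k) (hσ : σ.mat = diagConj W q) :
    ((entropyGap W φ.mat / Real.log 2 : ℝ) : EReal) ≤ relEntropy φ σ := by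
  obtain ⟨U, hU, p, hp, hUp⟩ := PosSemidef.exists_diagConj φ.posSemidef
  by_cases hs : ∀ x : n × n, q x.1 = 0 → overlap W U x * p x.2 = 0
  · rw [relEntropy_of_support hU hW hUp hσ hs, EReal.coe_le_coe_iff, hUp]
    exact div_le_div_of_nonneg_right (entropyGap_le_divSum hU hW hp hq hs
      ((QState.sum_eq_one hW hσ).trans (QState.sum_eq_one hU hUp).symm))
      (Real.log_nonneg one_le_two)
  · rw [relEntropy_of_not_support hU hW hUp hσ hs]
    exact le_top

theorem relEntropy_dephased {φ σ : QState n} {W : Matrix n n ℂ} (hW : W ∈ unitaryGroup n ℂ)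
    (hσ : σ.mat = diagConj W (basisDiag W φ.mat)) :
    relEntropy φ σ = ((entropyGap W φ.mat / Real.log 2 : ℝ) : EReal) := by
  obtain ⟨U, hU, p, hp, hUp⟩ := PosSemidef.exists_diagConj φ.posSemidef
  rw [hUp] at hσ ⊢
  rw [relEntropy_of_support hU hW hUp hσ fun x hx => support_basisDiag hp x hx,
    entropyGap_eq_divSum hU hW]

theorem exists_relEntropy_dephased {S : BipartiteSystem} (φ : State S) {W : Op S}
    (hW : IsLocalUnitary S W) :
    ∃ σ ∈ CC S, relEntropy φ σ = ((entropyGap W φ.mat / Real.log 2 : ℝ) : EReal) := by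
  have h0 := basisDiag_nonneg W φ.posSemidef
  have h1 : ∑ k, basisDiag W φ.mat k = 1 := by rw [sum_basisDiag hW.mem, φ.trace_re]
  refine ⟨⟨diagConj W (basisDiag W φ.mat), diagConj_posSemidef W h0, ?_⟩,
    mem_CC_iff.2 ⟨W, hW, _, h0, h1, rfl⟩, relEntropy_dephased hW.mem rfl⟩
  rw [trace_diagConj hW.mem, h1, Complex.ofReal_one]

/-- In each local basis the dephased state is optimal, so only the minimization over bases remains.
-/
theorem isLeast_relEntropy_of_min {S : BipartiteSystem} (φ : State S) {W : Op S}
    (hW : IsLocalUnitary S W)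
    (hmin : ∀ W', IsLocalUnitary S W' → entropyGap W φ.mat ≤ entropyGap W' φ.mat) :
    IsLeast (relEntropy φ '' CC S) ((entropyGap W φ.mat / Real.log 2 : ℝ) : EReal) := by
  refine ⟨exists_relEntropy_dephased φ hW, ?_⟩
  rintro _ ⟨σ, hσ, rfl⟩
  obtain ⟨W', hW', q, hq, -, hσ'⟩ := mem_CC_iff.1 hσ
  refine le_trans ?_ (entropyGap_le_relEntropy hW'.mem hq hσ')
  rw [EReal.coe_le_coe_iff]
  exact div_le_div_of_nonneg_right (hmin _ hW') (Real.log_nonneg one_le_two)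

theorem relDiscord_eq_of_min {S : BipartiteSystem} (φ : State S) {W : Op S}
    (hW : IsLocalUnitary S W)
    (hmin : ∀ W', IsLocalUnitary S W' → entropyGap W φ.mat ≤ entropyGap W' φ.mat) :
    relDiscord φ = entropyGap W φ.mat / Real.log 2 := by
  rw [relDiscord, ← sInf_image, (isLeast_relEntropy_of_min φ hW hmin).isGLB.sInf_eq,
    EReal.toReal_coe]

theorem exists_relDiscord_eq {S : BipartiteSystem} (φ : State S) :
    ∃ W, IsLocalUnitary S W ∧ relDiscord φ = entropyGap W φ.mat / Real.log 2 := by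
  obtain ⟨W, hW, hmin⟩ := exists_isLocalUnitary_min φ.mat
  exact ⟨W, hW, relDiscord_eq_of_min φ hW hmin⟩

theorem relDiscord_le {S : BipartiteSystem} (φ : State S) {W : Op S} (hW : IsLocalUnitary S W) :
    relDiscord φ ≤ entropyGap W φ.mat / Real.log 2 := by
  obtain ⟨W', hW', hmin⟩ := exists_isLocalUnitary_min φ.mat
  rw [relDiscord_eq_of_min φ hW' hmin]
  exact div_le_div_of_nonneg_right (hmin _ hW) (Real.log_nonneg one_le_two)

theorem isLeast_relDiscord {S : BipartiteSystem} (φ : State S) :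
    IsLeast (relEntropy φ '' CC S) (relDiscord φ : EReal) := by
  obtain ⟨W, hW, hmin⟩ := exists_isLocalUnitary_min φ.mat
  rw [relDiscord_eq_of_min φ hW hmin]
  exact isLeast_relEntropy_of_min φ hW hmin

theorem relDiscord_nonneg {S : BipartiteSystem} (φ : State S) : 0 ≤ relDiscord φ := by
  obtain ⟨W, hW, h⟩ := exists_relDiscord_eq φ
  rw [h]
  exact div_nonneg (entropyGap_nonneg hW.mem φ.posSemidef) (Real.log_nonneg one_le_two)

theorem isLocalUnitary_one (S : BipartiteSystem) : IsLocalUnitary S 1 :=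
  ⟨1, one_mem _, 1, one_mem _, one_kronecker_one.symm⟩

theorem relDiscord_le_logb_dim {S : BipartiteSystem} (φ : State S) :
    relDiscord φ ≤ Real.logb 2 S.dim := by
  refine (relDiscord_le φ (isLocalUnitary_one S)).trans ?_
  refine div_le_div_of_nonneg_right ?_ (Real.log_nonneg one_le_two)
  refine (entropyGap_le (one_mem _) φ.posSemidef).trans (le_of_eq ?_)
  rw [φ.trace_re, one_mul]
  rfl

/-- The relative entropy of discord does not increase under operations that preserve the
classical-classical states. -/
theorem relDiscord_le_of_map {O : OpClass} (hO : IsFreeOperations O) {S T : BipartiteSystem}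
    {φ : State S} {ψ : State T} {Φ : Op S →ₗ[ℂ] Op T} (hΦ : Φ ∈ O S T)
    (h : Φ φ.mat = ψ.mat) : relDiscord ψ ≤ relDiscord φ := by
  -- The image of the closest classical-classical state is a competitor for `ψ`.
  obtain ⟨σ, hσ, hval⟩ := (isLeast_relDiscord φ).1
  obtain ⟨τ, hτ, hστ⟩ := hO.preservesCC S T Φ hΦ σ hσ
  have h1 := (hO.quantumOperation S T Φ hΦ).relEntropy_le h hστ
  have h2 := (isLeast_relDiscord ψ).2 ⟨τ, hτ, rfl⟩
  rw [hval] at h1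
  exact EReal.coe_le_coe_iff.1 (h2.trans h1)

end LocalBases

/-! ## Continuity -/

section Continuity

open Matrix

variable {n : Type} [Fintype n] [DecidableEq n]

theorem traceNorm_diagConj {U : Matrix n n ℂ} (hU : U ∈ unitaryGroup n ℂ) (p : n → ℝ) :
    traceNorm (diagConj U p) = ∑ i, |p i| := by
  have h1 : (diagConj U p)ᴴ * diagConj U p = diagConj U (fun i => p i * p i) := by
    rw [(diagConj_isHermitian U p).eq, diagConj_mul hU]
  have h2 : traceNorm (diagConj U p) = eigSum Real.sqrt ((diagConj U p)ᴴ * diagConj U p) := by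
    rw [eigSum, dif_pos (isHermitian_conjTranspose_mul_self _)]
    rfl
  rw [h2, h1, eigSum_diagConj _ hU]
  exact Finset.sum_congr rfl fun i _ => Real.sqrt_mul_self_eq_abs _

theorem traceNorm_nonneg (M : Matrix n n ℂ) : 0 ≤ traceNorm M :=
  Finset.sum_nonneg fun _ _ => Real.sqrt_nonneg _

/-- The Jordan decomposition of the difference of two states. -/
theorem QState.exists_jordan (φ ψ : QState n) :
    ∃ P N : Matrix n n ℂ, P.PosSemidef ∧ N.PosSemidef ∧ ψ.mat + P = φ.mat + N ∧
      P.trace.re = traceNorm (φ.mat - ψ.mat) / 2 ∧ N.trace.re = traceNorm (φ.mat - ψ.mat) / 2 := by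
  have hM : (φ.mat - ψ.mat).IsHermitian := φ.posSemidef.1.sub ψ.posSemidef.1
  obtain ⟨U, hU, l, hl⟩ : ∃ U ∈ unitaryGroup n ℂ, ∃ l : n → ℝ, φ.mat - ψ.mat = diagConj U l :=
    ⟨_, hM.eigenvectorUnitary.2, _, diagConj_eigen hM⟩
  have hadd : diagConj U (fun i => max (l i) 0) =
      diagConj U l + diagConj U (fun i => max (-l i) 0) := by
    rw [← diagConj_add]
    congr 1
    ext i
    rw [Pi.add_apply]
    rcases le_total 0 (l i) with h | h
    · rw [max_eq_left h, max_eq_right (by linarith), add_zero]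
    · rw [max_eq_right h, max_eq_left (by linarith), add_neg_cancel]
  have hsum : ∑ i, l i = 0 := by
    have := congrArg trace hl
    rw [trace_sub, φ.trace_eq_one, ψ.trace_eq_one, sub_self, trace_diagConj hU] at this
    exact_mod_cast this.symm
  have hT : traceNorm (φ.mat - ψ.mat) = ∑ i, |l i| := by rw [hl, traceNorm_diagConj hU]
  refine ⟨diagConj U (fun i => max (l i) 0), diagConj U (fun i => max (-l i) 0),
    diagConj_posSemidef U fun i => le_max_right _ _,
    diagConj_posSemidef U fun i => le_max_right _ _, ?_, ?_, ?_⟩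
  · rw [hadd, ← hl]
    abel
  · rw [trace_diagConj hU, Complex.ofReal_re, hT, Finset.sum_div]
    have : ∀ i, max (l i) 0 = |l i| / 2 + l i / 2 := fun i => by
      rcases le_total 0 (l i) with h | h
      · rw [max_eq_left h, abs_of_nonneg h]; ring
      · rw [max_eq_right h, abs_of_nonpos h]; ring
    simp only [this, Finset.sum_add_distrib, ← Finset.sum_div, hsum]
    ring
  · rw [trace_diagConj hU, Complex.ofReal_re, hT, Finset.sum_div]
    have : ∀ i, max (-l i) 0 = |l i| / 2 - l i / 2 := fun i => by
      rcases le_total 0 (l i) with h | h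
      · rw [max_eq_right (by linarith), abs_of_nonneg h]; ring
      · rw [max_eq_left (by linarith), abs_of_nonpos h]; ring
    simp only [this, Finset.sum_sub_distrib, ← Finset.sum_div, hsum]
    ring

/-- In an eigenbasis of the difference, each eigenvalue is a difference of diagonal entries of the
two states, and both diagonals are nonnegative with sum one. -/
theorem QState.traceNorm_sub_le (φ ψ : QState n) : traceNorm (φ.mat - ψ.mat) ≤ 2 := by
  have hM : (φ.mat - ψ.mat).IsHermitian := φ.posSemidef.1.sub ψ.posSemidef.1
  obtain ⟨W, hW, l, hl⟩ : ∃ W ∈ unitaryGroup n ℂ, ∃ l : n → ℝ, φ.mat - ψ.mat = diagConj W l :=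
    ⟨_, hM.eigenvectorUnitary.2, _, diagConj_eigen hM⟩
  have h1 : ∀ i, |l i| ≤ basisDiag W φ.mat i + basisDiag W ψ.mat i := by
    intro i
    have h2 : basisDiag W φ.mat i = l i + basisDiag W ψ.mat i := by
      rw [← basisDiag_diagConj_self hW l, ← hl, ← basisDiag_add,
        sub_add_cancel]
    have h3 := basisDiag_nonneg W φ.posSemidef i
    have h4 := basisDiag_nonneg W ψ.posSemidef i
    rw [abs_le]
    constructor <;> linarith
  rw [hl, traceNorm_diagConj hW]
  refine (Finset.sum_le_sum fun i _ => h1 i).trans (le_of_eq ?_)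
  rw [Finset.sum_add_distrib, sum_basisDiag hW, sum_basisDiag hW, φ.trace_re, ψ.trace_re]
  norm_num

/-- With `ψ + P = φ + N`, bound the gap of the common operator below by approximate concavity and
above by subadditivity; then discard the gap of `P` and bound that of `N` by `ε log D`. -/
theorem entropyGap_sub_le {W : Matrix n n ℂ} (hW : W ∈ unitaryGroup n ℂ) (φ ψ : QState n)
    {ε : ℝ} (hε : traceNorm (φ.mat - ψ.mat) / 2 = ε) :
    entropyGap W ψ.mat - entropyGap W φ.mat ≤
      ε * Real.log (Fintype.card n) + Real.negMulLog ε - Real.negMulLog (1 + ε) := by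
  obtain ⟨P, N, hP, hN, hPN, hPt, hNt⟩ := φ.exists_jordan ψ
  rw [hε] at hPt hNt
  have h1 := le_entropyGap_add hW ψ.posSemidef hP
  have h2 := entropyGap_add_le hW φ.posSemidef hN
  have h3 := entropyGap_le hW hN
  have h4 := entropyGap_nonneg hW hP
  rw [ψ.trace_re, hPt, Real.negMulLog_one, hPN] at h1
  rw [hNt] at h3
  linarith

theorem h₂_eq (x : ℝ) : h₂ x = (Real.negMulLog x + Real.negMulLog (1 - x)) / Real.log 2 := by
  simp only [h₂, Real.logb, Real.negMulLog]
  ring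

theorem h₂_nonneg {x : ℝ} (h0 : 0 ≤ x) (h1 : x ≤ 1) : 0 ≤ h₂ x := by
  rw [h₂_eq]
  exact div_nonneg (add_nonneg (Real.negMulLog_nonneg h0 h1)
    (Real.negMulLog_nonneg (by linarith) (by linarith))) (Real.log_nonneg one_le_two)

/-- On `[1, 2]` the convex function `x log x` lies below its chord. -/
theorem neg_negMulLog_one_add_le {ε : ℝ} (h0 : 0 ≤ ε) (h1 : ε ≤ 1) :
    -Real.negMulLog (1 + ε) ≤ 2 * ε * Real.log 2 := by
  have h := Real.convexOn_mul_log.2 (Set.mem_Ici.2 zero_le_one) (Set.mem_Ici.2 zero_le_two)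
    (sub_nonneg.2 h1) h0 (by ring)
  simp only [smul_eq_mul, Real.log_one, mul_zero, zero_add] at h
  have e : (1 - ε) * 1 + ε * 2 = 1 + ε := by ring
  rw [e] at h
  rw [Real.negMulLog]
  linarith

/-- For `ε ≤ 1/2` the basis optimal for `φ` is used for `ψ` too. The surplus `2 ε log 2` from
`neg_negMulLog_one_add_le` is split in halves, one absorbed by a second `ε log D`, the other by a
second `negMulLog ε`. -/
theorem relDiscord_sub_le {S : BipartiteSystem} (φ ψ : State S) :
    relDiscord ψ - relDiscord φ ≤ traceNorm (φ.mat - ψ.mat) * Real.logb 2 S.dim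
      + 2 * h₂ (traceNorm (φ.mat - ψ.mat) / 2) := by
  set ε := traceNorm (φ.mat - ψ.mat) / 2 with hε
  have hT : traceNorm (φ.mat - ψ.mat) = 2 * ε := by rw [hε]; ring
  have h0 : 0 ≤ ε := div_nonneg (traceNorm_nonneg _) zero_le_two
  have h1 : ε ≤ 1 := by have := φ.traceNorm_sub_le ψ; linarith
  have hh := h₂_nonneg h0 h1
  have hl2 : 0 < Real.log 2 := Real.log_pos one_lt_two
  have hψ := relDiscord_le_logb_dim ψ
  have hφ := relDiscord_nonneg φ
  have hψ0 := relDiscord_nonneg ψ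
  rw [hT]
  by_cases hD : 2 ≤ S.dim
  · rcases le_total ε (1 / 2) with h2 | h2
    · obtain ⟨W, hW, hval⟩ := exists_relDiscord_eq φ
      have hle := relDiscord_le ψ hW
      have hgap := entropyGap_sub_le hW.mem φ ψ hε.symm
      have hdim : (Fintype.card S.Idx : ℝ) = S.dim := rfl
      rw [hdim] at hgap
      have h3 := neg_negMulLog_one_add_le h0 h1
      have h4 : Real.log 2 ≤ Real.log S.dim :=
        Real.log_le_log two_pos (by exact_mod_cast hD)
      -- This is where `ε ≤ 1/2` is needed.
      have h5 : ε * Real.log 2 ≤ Real.negMulLog ε := by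
        rcases h0.eq_or_lt with h | h
        · simp [← h]
        · have h6 := Real.log_le_log h h2
          rw [one_div, Real.log_inv] at h6
          rw [Real.negMulLog]
          nlinarith
      have h6 : 0 ≤ Real.negMulLog (1 - ε) := Real.negMulLog_nonneg (by linarith) (by linarith)
      have h7 : ε * Real.log 2 ≤ ε * Real.log S.dim := mul_le_mul_of_nonneg_left h4 h0
      rw [hval, h₂_eq, Real.logb]
      refine (sub_le_sub_right hle _).trans ?_
      have e : 2 * ε * (Real.log S.dim / Real.log 2) +
          2 * ((Real.negMulLog ε + Real.negMulLog (1 - ε)) / Real.log 2) =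
          (2 * ε * Real.log S.dim + 2 * (Real.negMulLog ε + Real.negMulLog (1 - ε))) /
            Real.log 2 := by ring
      rw [← sub_div, e]
      refine div_le_div_of_nonneg_right ?_ hl2.le
      linarith
    -- For `ε ≥ 1/2` the trivial bound `log D ≤ 2 ε log D` suffices.
    · have hlog : 0 ≤ Real.logb 2 S.dim := hψ0.trans hψ
      nlinarith
  -- In dimension at most one the discord vanishes.
  · have : Real.logb 2 S.dim = 0 := by
      interval_cases S.dim <;> simp
    rw [this] at hψ ⊢
    linarith

theorem traceNorm_sub_comm (φ ψ : QState n) :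
    traceNorm (φ.mat - ψ.mat) = traceNorm (ψ.mat - φ.mat) := by
  have : (φ.mat - ψ.mat)ᴴ * (φ.mat - ψ.mat) = (ψ.mat - φ.mat)ᴴ * (ψ.mat - φ.mat) := by
    rw [← neg_sub ψ.mat φ.mat, conjTranspose_neg, neg_mul_neg]
  simp only [traceNorm, this]

theorem abs_relDiscord_sub_le {S : BipartiteSystem} (φ ψ : State S) :
    |relDiscord φ - relDiscord ψ| ≤ traceNorm (φ.mat - ψ.mat) * Real.logb 2 S.dim
      + 2 * h₂ (traceNorm (φ.mat - ψ.mat) / 2) := by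
  rw [abs_le]
  constructor
  · have := relDiscord_sub_le φ ψ
    linarith
  · have := relDiscord_sub_le ψ φ
    rwa [traceNorm_sub_comm ψ φ] at this

theorem dim_pow (S : BipartiteSystem) (k : ℕ) : (S.pow k).dim = S.dim ^ k := by
  have ht : ∀ S T : BipartiteSystem, (S.tensor T).dim = S.dim * T.dim := fun S T =>
    (Fintype.card_congr (regroup S T)).symm.trans (Fintype.card_prod _ _)
  induction k with
  | zero => rfl
  | succ k ih => rw [pow_succ, ← ih, BipartiteSystem.pow, ht]

theorem logb_dim_pow (S : BipartiteSystem) (k : ℕ) :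
    Real.logb 2 (S.pow k).dim = k * Real.logb 2 S.dim := by
  rw [dim_pow, Nat.cast_pow, Real.logb_pow]

theorem continuous_h₂ : Continuous h₂ := by
  have : h₂ = fun x => (Real.negMulLog x + Real.negMulLog (1 - x)) / Real.log 2 := funext h₂_eq
  rw [this]
  fun_prop

/-- The dimension term is proportional to `k` and the entropy term only shrinks on division by `k ≥
1`, so the bound is uniform in `k`. -/
theorem abs_relDiscord_sub_div_le {S : BipartiteSystem} {k : ℕ} (hk : 0 < k)
    (φ ψ : State (S.pow k)) :
    |relDiscord φ - relDiscord ψ| / k ≤ traceNorm (φ.mat - ψ.mat) * Real.logb 2 S.dim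
      + 2 * h₂ (traceNorm (φ.mat - ψ.mat) / 2) := by
  have hk0 : (0 : ℝ) < k := by exact_mod_cast hk
  have hk1 : (1 : ℝ) ≤ k := by exact_mod_cast hk
  have hh : 0 ≤ h₂ (traceNorm (φ.mat - ψ.mat) / 2) :=
    h₂_nonneg (div_nonneg (traceNorm_nonneg _) zero_le_two)
      (by have := φ.traceNorm_sub_le ψ; linarith)
  rw [div_le_iff₀ hk0]
  refine (abs_relDiscord_sub_le φ ψ).trans ?_
  rw [logb_dim_pow]
  nlinarith

theorem tendsto_continuity_bound (c : ℝ) :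
    Tendsto (fun x : ℝ => x * c + 2 * h₂ (x / 2)) (𝓝 0) (𝓝 0) := by
  have h : Continuous fun x : ℝ => x * c + 2 * h₂ (x / 2) := by
    have := continuous_h₂
    fun_prop
  simpa [h₂] using h.tendsto 0

theorem isAsymptoticallyContinuous_relDiscord :
    IsAsymptoticallyContinuous (fun _ φ => relDiscord φ) := by
  intro S k hk φ ψ h
  refine squeeze_zero (fun i => by positivity)
    (fun i => abs_relDiscord_sub_div_le (hk i) (φ i) (ψ i)) ?_
  exact (tendsto_continuity_bound (Real.logb 2 S.dim)).comp h

end Continuity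

/-! ## Relabelling and tensor products -/

section Reindex

open Matrix

variable {m n : Type} [Fintype m] [Fintype n] [DecidableEq m] [DecidableEq n]

theorem submatrix_mem_unitaryGroup (e : m ≃ n) {U : Matrix n n ℂ} (hU : U ∈ unitaryGroup n ℂ) :
    U.submatrix e e ∈ unitaryGroup m ℂ := by
  rw [mem_unitaryGroup_iff, star_eq_conjTranspose, conjTranspose_submatrix, submatrix_mul_equiv,
    mul_conjTranspose_self_of_mem hU, submatrix_one_equiv]

theorem diagConj_submatrix (e : m ≃ n) (U : Matrix n n ℂ) (p : n → ℝ) :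
    (diagConj U p).submatrix e e = diagConj (U.submatrix e e) (p ∘ e) := by
  ext x y
  rw [submatrix_apply, diagConj_apply, diagConj_apply]
  exact (e.sum_comp fun k => (p k : ℂ) * (U (e x) k * star (U (e y) k))).symm

theorem entropyGap_submatrix (e : m ≃ n) (W : Matrix n n ℂ) {M : Matrix n n ℂ}
    (hM : M.PosSemidef) : entropyGap (W.submatrix e e) (M.submatrix e e) = entropyGap W M := by
  obtain ⟨U, hU, p, hp, rfl⟩ := PosSemidef.exists_diagConj hM
  rw [entropyGap, entropyGap, basisEntropy, basisEntropy]
  congr 1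
  · rw [← e.sum_comp]
    refine Finset.sum_congr rfl fun k _ => ?_
    rw [basisDiag, conjTranspose_submatrix, submatrix_mul_equiv, submatrix_mul_equiv]
    rfl
  · rw [diagConj_submatrix, entropy, entropy, eigSum_diagConj _ hU,
      eigSum_diagConj _ (submatrix_mem_unitaryGroup e hU)]
    exact e.sum_comp fun k => Real.negMulLog (p k)

variable {S T : BipartiteSystem}

theorem relDiscord_le_of_relabel {ρ : State S} {σ : State T} (eA : S.A ≃ T.A) (eB : S.B ≃ T.B)
    (h : ρ.mat = σ.mat.submatrix (eA.prodCongr eB) (eA.prodCongr eB)) :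
    relDiscord ρ ≤ relDiscord σ := by
  obtain ⟨_, ⟨U, hU, V, hV, rfl⟩, hval⟩ := exists_relDiscord_eq σ
  have hloc : IsLocalUnitary S ((U ⊗ₖ V).submatrix (eA.prodCongr eB) (eA.prodCongr eB)) :=
    ⟨_, submatrix_mem_unitaryGroup eA hU, _, submatrix_mem_unitaryGroup eB hV, rfl⟩
  refine (relDiscord_le ρ hloc).trans (le_of_eq ?_)
  rw [hval, h, entropyGap_submatrix _ _ σ.posSemidef]

theorem tensorOp_apply (X : Op S) (Y : Op T) (i j : S.Idx) (k l : T.Idx) :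
    tensorOp X Y (regroup S T (i, k)) (regroup S T (j, l)) = X i j * Y k l := rfl

theorem tensorOp_mul (X X' : Op S) (Y Y' : Op T) :
    tensorOp X Y * tensorOp X' Y' = tensorOp (X * X') (Y * Y') := by
  rw [tensorOp, tensorOp, tensorOp, mul_kronecker_mul, reindex_apply, reindex_apply,
    reindex_apply, submatrix_mul_equiv]

theorem tensorOp_conjTranspose (X : Op S) (Y : Op T) :
    (tensorOp X Y)ᴴ = tensorOp Xᴴ Yᴴ := by
  rw [tensorOp, tensorOp, reindex_apply, reindex_apply, conjTranspose_submatrix,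
    conjTranspose_kronecker]

theorem IsLocalUnitary.tensor {W : Op S} {W' : Op T} (hW : IsLocalUnitary S W)
    (hW' : IsLocalUnitary T W') : IsLocalUnitary (S.tensor T) (tensorOp W W') := by
  obtain ⟨U, hU, V, hV, rfl⟩ := hW
  obtain ⟨U', hU', V', hV', rfl⟩ := hW'
  refine ⟨U ⊗ₖ U', kronecker_mem_unitary hU hU', V ⊗ₖ V', kronecker_mem_unitary hV hV', ?_⟩
  ext x y
  exact mul_mul_mul_comm _ _ _ _

theorem sum_tensor {R : Type*} [AddCommMonoid R] (f : (S.tensor T).Idx → R) :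
    ∑ k, f k = ∑ i, ∑ j, f (regroup S T (i, j)) := by
  rw [← (regroup S T).sum_comp, Fintype.sum_prod_type]

theorem sum_negMulLog_mul {ι κ : Type*} [Fintype ι] [Fintype κ] {p : ι → ℝ} {q : κ → ℝ}
    (hp : ∑ i, p i = 1) (hq : ∑ j, q j = 1) :
    ∑ i, ∑ j, Real.negMulLog (p i * q j) =
      ∑ i, Real.negMulLog (p i) + ∑ j, Real.negMulLog (q j) := by
  simp only [Real.negMulLog_mul, Finset.sum_add_distrib, ← Finset.sum_mul, ← Finset.mul_sum, hp,
    hq, one_mul]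

theorem tensorOp_diagConj (U : Op S) (V : Op T) (p : S.Idx → ℝ) (q : T.Idx → ℝ) :
    tensorOp (diagConj U p) (diagConj V q) = diagConj (tensorOp U V)
      (fun k => p ((regroup S T).symm k).1 * q ((regroup S T).symm k).2) := by
  have : diagonal (fun k => ((p ((regroup S T).symm k).1 * q ((regroup S T).symm k).2 : ℝ) : ℂ)) =
      tensorOp (diagonal fun i => (p i : ℂ)) (diagonal fun i => (q i : ℂ)) := by
    rw [tensorOp, diagonal_kronecker_diagonal, reindex_apply, submatrix_diagonal_equiv]
    congr 1
    ext k
    simp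
  rw [diagConj, diagConj, diagConj, this, tensorOp_conjTranspose, tensorOp_mul, tensorOp_mul]

theorem tensorOp_mem_unitaryGroup {U : Op S} {V : Op T} (hU : U ∈ unitaryGroup S.Idx ℂ)
    (hV : V ∈ unitaryGroup T.Idx ℂ) : tensorOp U V ∈ unitaryGroup (S.tensor T).Idx ℂ :=
  submatrix_mem_unitaryGroup (regroup S T).symm (kronecker_mem_unitary hU hV)

theorem entropy_tensor (ρ : State S) (σ : State T) :
    entropy (State.tensor ρ σ).mat = entropy ρ.mat + entropy σ.mat := by
  obtain ⟨U, hU, p, hp, hUp⟩ := PosSemidef.exists_diagConj ρ.posSemidef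
  obtain ⟨V, hV, q, hq, hVq⟩ := PosSemidef.exists_diagConj σ.posSemidef
  have h : (State.tensor ρ σ).mat = tensorOp (diagConj U p) (diagConj V q) := by
    rw [← hUp, ← hVq]
    rfl
  rw [h, tensorOp_diagConj, entropy, eigSum_diagConj _ (tensorOp_mem_unitaryGroup hU hV),
    sum_tensor, hUp, hVq, entropy, entropy, eigSum_diagConj _ hU, eigSum_diagConj _ hV,
    ← sum_negMulLog_mul (QState.sum_eq_one hU hUp) (QState.sum_eq_one hV hVq)]
  simp only [Equiv.symm_apply_apply]

theorem basisDiag_tensor {W : Op S} {W' : Op T} (ρ : State S) (σ : State T) (i : S.Idx)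
    (j : T.Idx) : basisDiag (tensorOp W W') (State.tensor ρ σ).mat (regroup S T (i, j)) =
      basisDiag W ρ.mat i * basisDiag W' σ.mat j := by
  have h : (tensorOp W W')ᴴ * (State.tensor ρ σ).mat * tensorOp W W' =
      tensorOp (Wᴴ * ρ.mat * W) (W'ᴴ * σ.mat * W') := by
    rw [tensorOp_conjTranspose, ← tensorOp_mul, ← tensorOp_mul]
    rfl
  -- Diagonal entries of a positive matrix are real, so the real part of the product is the product
  -- of the real parts.
  have him := (Complex.le_def.1
    ((ρ.posSemidef.conjTranspose_mul_mul_same W).diag_nonneg (i := i))).2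
  rw [basisDiag, h, tensorOp_apply, Complex.mul_re, ← him]
  simp [basisDiag]

theorem entropyGap_tensor {W : Op S} {W' : Op T} (hW : W ∈ unitaryGroup S.Idx ℂ)
    (hW' : W' ∈ unitaryGroup T.Idx ℂ) (ρ : State S) (σ : State T) :
    entropyGap (tensorOp W W') (State.tensor ρ σ).mat =
      entropyGap W ρ.mat + entropyGap W' σ.mat := by
  rw [entropyGap, entropyGap, entropyGap, entropy_tensor, basisEntropy, sum_tensor]
  simp only [basisDiag_tensor]
  rw [sum_negMulLog_mul (by rw [sum_basisDiag hW, ρ.trace_re])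
    (by rw [sum_basisDiag hW', σ.trace_re]), basisEntropy, basisEntropy]
  ring

/-- Use the product of the two optimal local bases: both entropies in the gap are additive on
product states. -/
theorem relDiscord_tensor_le (ρ : State S) (σ : State T) :
    relDiscord (State.tensor ρ σ) ≤ relDiscord ρ + relDiscord σ := by
  obtain ⟨W, hW, h⟩ := exists_relDiscord_eq ρ
  obtain ⟨W', hW', h'⟩ := exists_relDiscord_eq σ
  refine (relDiscord_le _ (hW.tensor hW')).trans (le_of_eq ?_)
  rw [entropyGap_tensor hW.mem hW'.mem, h, h', add_div]

/-- Tensor powers append one factor at a time, so the splitting holds only up to reassociation. The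
relabelling acts on each party separately and hence respects local bases. -/
theorem exists_relabel_pow_add (φ : State S) (j k : ℕ) :
    ∃ (eA : (S.pow (j + k)).A ≃ ((S.pow j).tensor (S.pow k)).A)
      (eB : (S.pow (j + k)).B ≃ ((S.pow j).tensor (S.pow k)).B),
      ∀ x y, (State.pow φ (j + k)).mat x y =
        (State.tensor (State.pow φ j) (State.pow φ k)).mat
          (eA x.1, eB x.2) (eA y.1, eB y.2) := by
  induction k with
  | zero =>
    refine ⟨(Equiv.prodPUnit _).symm, (Equiv.prodPUnit _).symm, fun x y => ?_⟩
    exact ((congrArg ((State.pow φ j).mat x y * ·)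
      (Matrix.one_apply_eq (α := ℂ) (((), ()) : Unit × Unit))).trans (mul_one _)).symm
  | succ k ih =>
    obtain ⟨eA, eB, h⟩ := ih
    refine ⟨(eA.prodCongr (Equiv.refl S.A)).trans (Equiv.prodAssoc _ _ _),
      (eB.prodCongr (Equiv.refl S.B)).trans (Equiv.prodAssoc _ _ _), fun x y => ?_⟩
    change (State.pow φ (j + k)).mat (x.1.1, x.2.1) (y.1.1, y.2.1) *
      φ.mat (x.1.2, x.2.2) (y.1.2, y.2.2) = _
    rw [h]
    exact mul_assoc _ _ _

theorem subadditive_relDiscord_pow (φ : State S) :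
    Subadditive fun k => relDiscord (State.pow φ k) := by
  intro j k
  obtain ⟨eA, eB, h⟩ := exists_relabel_pow_add φ j k
  exact (relDiscord_le_of_relabel eA eB (Matrix.ext h)).trans (relDiscord_tensor_le _ _)

/-- Fekete's lemma gives convergence, so `limUnder` is the actual limit. -/
theorem tendsto_regularization (φ : State S) :
    Tendsto (fun k : ℕ => relDiscord (State.pow φ k) / k) atTop
      (𝓝 (regularization (fun _ φ => relDiscord φ) S φ)) := by
  have h := (subadditive_relDiscord_pow φ).tendsto_lim
    ⟨0, by rintro _ ⟨k, rfl⟩; exact div_nonneg (relDiscord_nonneg _) (Nat.cast_nonneg k)⟩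
  rw [regularization, h.limUnder_eq]
  exact h

theorem regularization_nonneg (φ : State S) :
    0 ≤ regularization (fun _ φ => relDiscord φ) S φ :=
  ge_of_tendsto' (tendsto_regularization φ) fun k =>
    div_nonneg (relDiscord_nonneg _) (Nat.cast_nonneg k)

end Reindex

/-! ## Consistency -/

section Consistency

variable {S T : BipartiteSystem}

theorem IsQuantumOperation.posSemidef {m n : Type} [Fintype m] [Fintype n] [DecidableEq m]
    [DecidableEq n] {Φ : Matrix m m ℂ →ₗ[ℂ] Matrix n n ℂ} (hΦ : IsQuantumOperation Φ)
    {M : Matrix m m ℂ} (hM : M.PosSemidef) : (Φ M).PosSemidef :=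
  (hΦ.completelyPositive 1 _ (hM.submatrix Prod.fst)).submatrix fun i => (i, 0)

/-- The image of a state under a quantum operation. -/
def IsQuantumOperation.mapState {m n : Type} [Fintype m] [Fintype n] [DecidableEq m]
    [DecidableEq n] {Φ : Matrix m m ℂ →ₗ[ℂ] Matrix n n ℂ} (hΦ : IsQuantumOperation Φ)
    (ρ : QState m) : QState n where
  mat := Φ ρ.mat
  posSemidef := hΦ.posSemidef ρ.posSemidef
  trace_eq_one := by rw [hΦ.tracePreserving, ρ.trace_eq_one]

theorem frequently_traceNorm_lt {O : OpClass} (hO : IsFreeOperations O) {φ : State S}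
    {ψ : State T} {r : ℝ≥0} {Φ : ∀ n : ℕ, Op (S.pow n) →ₗ[ℂ] Op (T.pow ⌈r * n⌉₊)}
    (hΦ : ∀ n, 0 < n → Φ n ∈ O (S.pow n) (T.pow ⌈r * n⌉₊))
    (hlim : liminf (fun n => traceNorm (Φ n (State.pow φ n).mat -
      (State.pow ψ ⌈r * n⌉₊).mat)) atTop = 0) {ε : ℝ} (hε : 0 < ε) :
    ∃ᶠ n in atTop, traceNorm (Φ n (State.pow φ n).mat - (State.pow ψ ⌈r * n⌉₊).mat) < ε := by
  refine frequently_lt_of_liminf_lt ?_ (hlim.trans_lt hε)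
  -- A real `liminf` is informative only for bounded sequences. The bound `2` is available for `n >
  -- 0`, where `Φ n` is a free operation.
  refine IsBoundedUnder.isCoboundedUnder_ge ⟨2, ?_⟩
  rw [eventually_map]
  filter_upwards [eventually_gt_atTop 0] with n hn
  exact ((hO.quantumOperation _ _ _ (hΦ n hn)).mapState (State.pow φ n)).traceNorm_sub_le
    (State.pow ψ ⌈r * n⌉₊)

/-- If `r L' > L` with gap `δ`, then for large `n` the target has more discord than the source by `n
δ / 2`. But for infinitely many `n` some operation output has at most the discord of the source and
is too close to the target for such a difference. -/
theorem IsAchievableRate.mul_le {O : OpClass} (hO : IsFreeOperations O) {φ : State S}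
    {ψ : State T} {r : ℝ≥0} (h : IsAchievableRate O φ ψ r) :
    r * regularization (fun _ φ => relDiscord φ) T ψ ≤
      regularization (fun _ φ => relDiscord φ) S φ := by
  -- For `r = 0` the number of output copies does not tend to infinity.
  rcases eq_or_ne r 0 with rfl | hr
  · simpa using regularization_nonneg φ
  have hr0 : (0 : ℝ) < r := by exact_mod_cast pos_iff_ne_zero.2 hr
  obtain ⟨Φ, hΦ, hlim⟩ := h
  set L := regularization (fun _ φ => relDiscord φ) S φ
  set L' := regularization (fun _ φ => relDiscord φ) T ψ
  by_contra! hlt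
  set δ := (r : ℝ) * L' - L with hδ
  have hδ0 : 0 < δ := sub_pos.2 hlt
  have hceil : Tendsto (fun n : ℕ => ⌈r * n⌉₊) atTop atTop :=
    tendsto_nat_ceil_atTop.comp
      (tendsto_natCast_atTop_atTop.const_mul_atTop (pos_iff_ne_zero.2 hr))
  have hratio : Tendsto (fun n : ℕ => ((⌈r * n⌉₊ : ℕ) : ℝ) / n) atTop (𝓝 r) := by
    have := (tendsto_nat_ceil_mul_div_atTop hr0.le).comp tendsto_natCast_atTop_atTop
    refine this.congr fun n => ?_
    have e : ⌈(r : ℝ) * n⌉₊ = ⌈r * (n : ℝ≥0)⌉₊ := by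
      refine eq_of_forall_ge_iff fun k => ?_
      rw [Nat.ceil_le, Nat.ceil_le]
      exact_mod_cast Iff.rfl
    simp only [Function.comp_apply, e]
  have h1 := (((tendsto_regularization ψ).comp hceil).mul hratio).sub (tendsto_regularization φ)
  rw [mul_comm] at h1
  have h2 : ∀ᶠ n : ℕ in atTop, δ / 2 <
      relDiscord (State.pow ψ ⌈r * n⌉₊) / (⌈r * n⌉₊ : ℕ) * ((⌈r * n⌉₊ : ℕ) / (n : ℝ)) -
        relDiscord (State.pow φ n) / n :=
    h1.eventually_const_lt (by linarith)
  have h3 : ∀ᶠ n : ℕ in atTop, ((⌈r * n⌉₊ : ℕ) : ℝ) / n < r + 1 :=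
    hratio.eventually_lt_const (by linarith)
  -- The tolerance is per output copy; as there are fewer than `(r + 1) n` copies, the total error
  -- stays below `n δ / 2`.
  have hb := (tendsto_continuity_bound (Real.logb 2 T.dim)).eventually_lt_const
    (show 0 < δ / 2 / (r + 1) by positivity)
  obtain ⟨ε, hε, hball⟩ := Metric.eventually_nhds_iff.1 hb
  obtain ⟨n, hTn, h2, h3, hm, hn⟩ := ((frequently_traceNorm_lt hO hΦ hlim hε).and_eventually
    (h2.and (h3.and ((hceil.eventually_gt_atTop 0).and (eventually_gt_atTop 0))))).exists
  set m := ⌈r * n⌉₊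
  set ρ : State (T.pow m) := (hO.quantumOperation _ _ _ (hΦ n hn)).mapState (State.pow φ n)
    with hρ
  have h4 : relDiscord ρ ≤ relDiscord (State.pow φ n) := relDiscord_le_of_map hO (hΦ n hn) rfl
  have h5 := abs_relDiscord_sub_div_le hm ρ (State.pow ψ m)
  have h6 : traceNorm (ρ.mat - (State.pow ψ m).mat) * Real.logb 2 T.dim +
      2 * h₂ (traceNorm (ρ.mat - (State.pow ψ m).mat) / 2) < δ / 2 / (r + 1) := by
    refine hball ?_
    rw [Real.dist_eq, sub_zero, abs_of_nonneg (traceNorm_nonneg _)]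
    exact hTn
  have h7 := h5.trans_lt h6
  have hm0 : (0 : ℝ) < m := by exact_mod_cast hm
  have hn0 : (0 : ℝ) < n := by exact_mod_cast hn
  rw [div_lt_iff₀ hm0] at h7
  have h8 := (abs_lt.1 h7).1
  have h9 : relDiscord (State.pow ψ m) / m * (m / (n : ℝ)) = relDiscord (State.pow ψ m) / n := by
    field_simp
  rw [h9, ← sub_div, lt_div_iff₀ hn0] at h2
  rw [div_lt_iff₀ hn0] at h3
  have h10 : δ / 2 / (r + 1) * m < δ / 2 * n := by
    calc δ / 2 / (r + 1) * m < δ / 2 / (r + 1) * ((r + 1) * n) :=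
          mul_lt_mul_of_pos_left h3 (by positivity)
      _ = δ / 2 * n := by field_simp
  linarith

theorem isConsistent_regularization {O : OpClass} (hO : IsFreeOperations O) :
    IsConsistent O (regularization (fun _ φ => relDiscord φ)) := by
  intro S T φ ψ
  rcases (regularization_nonneg ψ).eq_or_lt with h | h
  -- The rate may be infinite here; the convention `0 * ⊤ = 0` settles this case.
  · rw [← h, EReal.coe_zero, zero_mul]
    exact_mod_cast regularization_nonneg φ
  · set L := regularization (fun _ φ => relDiscord φ) S φ with hL
    set L' := regularization (fun _ φ => relDiscord φ) T ψ with hL'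
    have hL0 : 0 ≤ L := regularization_nonneg φ
    have h1 : conversionRate O φ ψ ≤ ENNReal.ofReal (L / L') := by
      refine iSup₂_le fun r hr => ?_
      rw [← ENNReal.ofReal_coe_nnreal]
      exact ENNReal.ofReal_le_ofReal ((le_div_iff₀ h).2 (hr.mul_le hO))
    have h2 : (conversionRate O φ ψ : EReal) ≤ ((L / L' : ℝ) : EReal) := by
      have := EReal.coe_ennreal_le_coe_ennreal_iff.2 h1
      rwa [EReal.coe_ennreal_ofReal, max_eq_left (div_nonneg hL0 h.le)] at this
    refine (mul_le_mul_of_nonneg_left h2 (by exact_mod_cast h.le)).trans (le_of_eq ?_)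
    rw [← EReal.coe_mul, mul_div_cancel₀ _ h.ne']

/-- The `k`-fold tensor power of a map. -/
def powMap (Φ : Op S →ₗ[ℂ] Op T) : ∀ k : ℕ, Op (S.pow k) →ₗ[ℂ] Op (T.pow k)
  | 0 => LinearMap.id
  | k + 1 => tensorMap (powMap Φ k) Φ

theorem powMap_mem {O : OpClass} (hO : IsTensorClosed O) {Φ : Op S →ₗ[ℂ] Op T} (hΦ : Φ ∈ O S T)
    (k : ℕ) : powMap Φ k ∈ O (S.pow k) (T.pow k) := by
  induction k with
  | zero => exact hO.id_mem _
  | succ k ih => exact hO.tensor_mem _ _ _ _ _ ih _ hΦ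

theorem powMap_apply {Φ : Op S →ₗ[ℂ] Op T} {φ : State S} {ψ : State T} (h : Φ φ.mat = ψ.mat)
    (k : ℕ) : powMap Φ k (State.pow φ k).mat = (State.pow ψ k).mat := by
  induction k with
  | zero => rfl
  | succ k ih =>
    change tensorMap (powMap Φ k) Φ (tensorOp (State.pow φ k).mat φ.mat) =
      tensorOp (State.pow ψ k).mat ψ.mat
    rw [tensorMap_tensorOp, ih, h]

theorem isResourceMeasure_regularization {O : OpClass} (hO : IsFreeOperations O)
    (hT : IsTensorClosed O) :
    IsResourceMeasure O (regularization (fun _ φ => relDiscord φ)) := by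
  rintro S T φ ψ ⟨Φ, hΦ, h⟩
  refine le_of_tendsto_of_tendsto' (tendsto_regularization ψ) (tendsto_regularization φ)
    fun k => div_le_div_of_nonneg_right ?_ (Nat.cast_nonneg k)
  -- Tensor powers of a free operation are free; the identity map is needed for the zeroth power.
  exact relDiscord_le_of_map hO (powMap_mem hT hΦ k) (powMap_apply h k)

end Consistency

end Discord

end

theorem mainTheorem3 :
    -- the minimum that defines the relative entropy of discord exists and is finite
    (∀ (S : Discord.BipartiteSystem) (φ : Discord.State S),
      IsLeast (Discord.relEntropy φ '' Discord.CC S) (Discord.relDiscord φ : EReal)) ∧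
    -- the continuity bound
    (∀ (S : Discord.BipartiteSystem) (φ ψ : Discord.State S),
      |Discord.relDiscord φ - Discord.relDiscord ψ| ≤
        Discord.traceNorm (φ.mat - ψ.mat) * Real.logb 2 S.dim
          + 2 * Discord.h₂ (Discord.traceNorm (φ.mat - ψ.mat) / 2)) ∧
    -- asymptotic continuity
    Discord.IsAsymptoticallyContinuous (fun _ φ => Discord.relDiscord φ) ∧
    -- the limit that defines the regularization exists
    (∀ (S : Discord.BipartiteSystem) (φ : Discord.State S),
      Filter.Tendsto (fun n : ℕ => Discord.relDiscord (Discord.State.pow φ n) / n) Filter.atTop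
        (nhds (Discord.regularization (fun _ φ => Discord.relDiscord φ) S φ))) ∧
    -- consistency, for every class of free operations
    (∀ O : Discord.OpClass, Discord.IsFreeOperations O →
      Discord.IsResourceMeasure O (fun _ φ => Discord.relDiscord φ) ∧
      Discord.IsConsistent O (Discord.regularization (fun _ φ => Discord.relDiscord φ)) ∧
      (Discord.IsTensorClosed O →
        Discord.IsResourceMeasure O
          (Discord.regularization (fun _ φ => Discord.relDiscord φ)))) := by

  refine ⟨fun S φ => Discord.isLeast_relDiscord φ, fun S φ ψ => Discord.abs_relDiscord_sub_le φ ψ,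
    Discord.isAsymptoticallyContinuous_relDiscord, fun S φ => Discord.tendsto_regularization φ,
    fun O hO => ⟨?_, Discord.isConsistent_regularization hO,
      fun hT => Discord.isResourceMeasure_regularization hO hT⟩⟩
  rintro S T φ ψ ⟨Φ, hΦ, h⟩
  exact Discord.relDiscord_le_of_map hO hΦ h
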